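/- **Setting.** Let $\mathcal T$ be the class of maps $g:\bigcup_k I_k\to J$ with a critical point $c$ such that: $\{I_k\}$ is a (finite or infinite) family of pairwise disjoint nondegenerate compact intervals in the interior of the compact interval $J$; for $k\ne0$ the map $g$ sends $I_k$ ($c\notin I_k$) $C^3$-diffeomorphically onto $J$, with Schwarzian derivative $\le0$; the central interval is $I_0=[c-r,c+r]$ with $r>0$, $g(I_0)\subset J$, $g(\partial I_0)\subset\partial J$, and $g|I_0=h\circ\phi$, where $\phi(x)=(x-c)^2$ and $h$ is a $C^3$ diffeomorphism of $[0,r^2]$ onto its image with Schwarzian derivative $\le 0$. Let $g\in\mathcal T$ have a recurrent critical point: all iterates $g^m(c)$ are defined and $c\in\omega(c)$. Put $g_1=g$, $I^0=J$, $I^1_k=I_k$, and inductively, writing $I^n=I^n_0\ni c$ for the central interval of $g_n:\bigcup_k I^n_k\to I^{n-1}$, let $g_{n+1}:\bigcup_k I^{n+1}_k\to I^n$ be the first return map of $g_n$ to $I^n$ restricted to those components of its domain that meet the orbit of $c$. Set - $\mu_n=|I^n|/|I^{n-1}|$; - $\lambda_n=\sup_{k\neq0}P(I^n_k\,|\,I^{n-1})$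 and $\lambda_n^*=\min(\lambda_n,1)$, where $P(G|L)=\log\left(1+\frac{|G|}{|U|}\right)+\log\left(1+\frac{|G|}{|V|}\right)$ and $U,V$ are the components of $L\setminus G$; - $K_n=\inf Q(U,V)$ over all pairs of distinct intervals $U,V$ of level $n$ with $U$ closer to $c$ than $V$ that either lie on the same side of $c$ or have $U$ central, where $Q(U,V)=\log\left(1+\frac{|G|}{|U|}\right)+\frac12\log\left(1+\frac{|G|}{|V|}\right)$ and $G$ is the gap between $U$ and $V$; - $\rho_n=\sup_k\sup_{z,w\in\phi(I^n_k)}\log\frac{|h_{n,k}'(z)|}{|h_{n,k}'(w)|}$, where $g_n|I^n_k=h_{n,k}\circ\phi$. **Lemma 3.13.** Let $0<\bar\rho<\bar\mu<1$ and $\epsilon>0$. There is a constant $C>0$, depending only on $\bar\mu$, $\bar\rho$ and $\epsilon$, with the following property. Let $g\in\mathcal T$ have a recurrent critical point $c$, and let $n\ge2$; if $n=2$, assume that $J$ is symmetric about $c$. Suppose that $\rho_i<\bar\rho$ and $\mu_i<\bar\mu$ for $i=n-1,n$, and that the return is non-central: $g_n(c)\notin I^n$. Then at least one of the following three estimates holds: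 $$\mu_{n+1}\le C\sqrt{\lambda_n^*}\,\exp\left(-(1-\epsilon)K_n/2\right),$$ $$\mu_{n+1}\le C\exp\left(-(1+\epsilon/2)K_n/2\right),$$ $$\mu_{n+1}\le C\sqrt{\mu_n\,\mu_{n-1}\,\lambda_{n-1}^*}.$$ -/

import Mathlib

open scoped ENNReal

noncomputable section

namespace BoxMap

/-! ## Closed intervals -/

/-- A compact interval `[fst, snd]` of the real line (with `fst ≤ snd`). -/
abbrev Seg := NonemptyInterval ℝ

/-- The set of points of a compact interval. -/
def pts (K : Seg) : Set ℝ := Set.Icc K.fst K.snd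

/-- The length `|K|`. -/
def len (K : Seg) : ℝ := K.snd - K.fst

/-! ## Smooth branches, Schwarzian derivative, distortion -/

/-- The Schwarzian derivative `f''' / f' - (3/2) (f'' / f')²`. -/
def schwarzian (f : ℝ → ℝ) (x : ℝ) : ℝ :=
  iteratedDeriv 3 f x / deriv f x - 3 / 2 * (iteratedDeriv 2 f x / deriv f x) ^ 2

/-- `f` restricted to `[a, b]` is a `C³` diffeomorphism onto its image (one-sided derivatives at
the endpoints) whose Schwarzian derivative is nowhere positive. -/
structure IsSDiffeo (f : ℝ → ℝ) (a b : ℝ) : Prop where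
  smooth : ContDiffOn ℝ 3 f (Set.Icc a b)
  deriv_ne : ∀ x ∈ Set.Icc a b, derivWithin f (Set.Icc a b) x ≠ 0
  schwarz : ∀ x ∈ Set.Ioo a b, schwarzian f x ≤ 0

/-- The distortion (non-linearity) of `f` on `S`: the supremum of `log (|f' x| / |f' y|)` over
`x, y ∈ S`.  It is a supremum of a nonempty family containing `0` as soon as `S` is nonempty, so
nothing is lost by taking it in `[0, ∞]`. -/
def distortion (f : ℝ → ℝ) (S : Set ℝ) : ℝ≥0∞ :=
  ⨆ x ∈ S, ⨆ y ∈ S, ENNReal.ofReal (Real.log (|derivWithin f S x| / |derivWithin f S y|))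

/-! ## Poincaré lengths -/

/-- The Poincaré length `P(G | L) = log (1 + |G| / |U|) + log (1 + |G| / |V|)` of `G ⊂ int L`,
where `U`, `V` are the two components of `L \ G`. -/
def poincareLen (G L : Seg) : ℝ :=
  Real.log (1 + len G / (G.fst - L.fst)) + Real.log (1 + len G / (L.snd - G.snd))

/-- The length of the gap between two disjoint intervals, that is, of the bounded component of
`ℝ \ (U ∪ V)`. -/
def gapLen (U V : Seg) : ℝ := max (V.fst - U.snd) (U.fst - V.snd)

/-- The asymmetric Poincaré length `Q(U, V)` of the gap `G` between `U` and `V`, where `U` is the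
interval closer to the critical point: `log (1 + |G| / |U|) + (1/2) log (1 + |G| / |V|)`. -/
def asymLen (U V : Seg) : ℝ :=
  Real.log (1 + gapLen U V / len U) + 1 / 2 * Real.log (1 + gapLen U V / len V)

/-- `U` and `V` are disjoint, `U` is closer to `c` than `V`, and the gap between them does not
contain `c`: either `U` contains `c`, or both lie on the same side of `c`. -/
def Closer (c : ℝ) (U V : Seg) : Prop :=
  (c ≤ U.snd ∧ U.snd < V.fst) ∨ (U.fst ≤ c ∧ V.snd < U.fst)

/-! ## Return maps -/

/-- The data of a map `g : ⋃ I_k → J` defined on a family of compact intervals (`pieces`).  The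
values of `g` off the union of the pieces are irrelevant. -/
structure RMap where
  J : Seg
  pieces : Set Seg
  g : ℝ → ℝ

/-- The class `𝒯` (with critical point `c`, the map being purely quadratic near `c`):
the pieces are pairwise disjoint nondegenerate compact intervals in the interior of `J`; every piece
not containing `c` is mapped diffeomorphically onto `J`; one piece is `I₀ = [c - r, c + r]`, and
there `g = h ∘ φ` with `φ x = (x - c)²` and `h` a diffeomorphism, and `g` is a unimodal map of
`I₀` into `J` carrying `∂I₀` into `∂J`.  All the diffeomorphisms have Schwarzian derivative
`≤ 0`. -/
structure ClassT (c : ℝ) (G : RMap) : Prop where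
  nondeg : ∀ K ∈ G.pieces, K.fst < K.snd
  interior : ∀ K ∈ G.pieces, G.J.fst < K.fst ∧ K.snd < G.J.snd
  disjoint : ∀ K ∈ G.pieces, ∀ K' ∈ G.pieces, K ≠ K' → Disjoint (pts K) (pts K')
  noncentral : ∀ K ∈ G.pieces, c ∉ pts K →
    IsSDiffeo G.g K.fst K.snd ∧ G.g '' pts K = pts G.J
  central : ∃ K ∈ G.pieces, ∃ r > 0, K.fst = c - r ∧ K.snd = c + r ∧
    ∃ h : ℝ → ℝ, IsSDiffeo h 0 (r ^ 2) ∧ (∀ x ∈ pts K, G.g x = h ((x - c) ^ 2)) ∧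
      h 0 ∈ pts G.J ∧ (h (r ^ 2) = G.J.fst ∨ h (r ^ 2) = G.J.snd)

/-- The critical point is recurrent: all its iterates are defined, and it is an accumulation point
of its own orbit, `c ∈ ω(c)`. -/
def Recurrent (c : ℝ) (G : RMap) : Prop :=
  (∀ m : ℕ, ∃ K ∈ G.pieces, G.g^[m] c ∈ pts K) ∧
    MapClusterPt c Filter.atTop (fun m : ℕ => G.g^[m] c)

open Classical in
/-- The central interval: the piece that contains `c` (`J` if there is none, which does not happen
for the maps of class `𝒯`). -/
def centralPiece (c : ℝ) (G : RMap) : Seg :=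
  if h : ∃ K ∈ G.pieces, c ∈ pts K then h.choose else G.J

/-- `K` is contained in the central interval `I`, and all its points return to `I` for the first
time at the moment `k ≥ 1`, passing before that through the same non-central pieces. -/
def IsReturnSeg (c : ℝ) (G : RMap) (k : ℕ) (K : Seg) : Prop :=
  1 ≤ k ∧ pts K ⊆ pts (centralPiece c G) ∧
    (∀ i, 1 ≤ i → i < k → ∃ K' ∈ G.pieces, c ∉ pts K' ∧ G.g^[i] '' pts K ⊆ pts K') ∧
    G.g^[k] '' pts K ⊆ pts (centralPiece c G)

/-- The first return time of `x` to the central interval. -/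
def returnTime (c : ℝ) (G : RMap) (x : ℝ) : ℕ :=
  sInf {k : ℕ | 1 ≤ k ∧ G.g^[k] x ∈ pts (centralPiece c G)}

/-- The pre-renormalization of `G`: the first return map to the central interval `I`, restricted to
those components of its domain (maximal intervals of points returning together) which meet the orbit
of the critical point. -/
def preRenorm (c : ℝ) (G : RMap) : RMap where
  J := centralPiece c G
  pieces := {K | (∃ k, Maximal (IsReturnSeg c G k) K) ∧ ∃ m : ℕ, G.g^[m] c ∈ pts K}
  g := fun x => G.g^[returnTime c G x] x

/-- The sequence `g_n : ⋃ I^n_k → I^{n-1}`, `n ≥ 1`: `g_1 = G` and `g_{n+1}` is the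
pre-renormalization of `g_n`. -/
def level (c : ℝ) (G : RMap) (n : ℕ) : RMap := (preRenorm c)^[n - 1] G

/-! ## Geometric parameters of a map `g : ⋃ I_k → J` -/

/-- The scaling factor `μ = |I₀| / |J|`. -/
def scaling (c : ℝ) (G : RMap) : ℝ := len (centralPiece c G) / len G.J

/-- `K`, the infimum of the asymmetric Poincaré lengths of the gaps between two pieces lying on the
same side of `c`, or one of which is central. -/
def gapParam (c : ℝ) (G : RMap) : ℝ :=
  sInf {q | ∃ U ∈ G.pieces, ∃ V ∈ G.pieces, Closer c U V ∧ q = asymLen U V}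

/-- `λ`, the supremum of the Poincaré lengths `P(I_k | J)` of the non-central pieces. -/
def lam (c : ℝ) (G : RMap) : ℝ≥0∞ :=
  ⨆ K ∈ {K ∈ G.pieces | c ∉ pts K}, ENNReal.ofReal (poincareLen K G.J)

/-- `λ* = min (λ, 1)`. -/
def lamStar (c : ℝ) (G : RMap) : ℝ := (min (lam c G) 1).toReal

/-- The factor `h` of the decomposition `g|K = h ∘ φ`, `φ x = (x - c)²`, as a function of
`z = φ x`. -/
def quadFactor (c : ℝ) (G : RMap) (K : Seg) (z : ℝ) : ℝ :=
  if K.snd < c then G.g (c - √z) else G.g (c + √z)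

/-- The distortion parameter `ρ`: the supremum over all pieces `K` of the distortion of `h` on
`φ(K)`, where `g|K = h ∘ φ`. -/
def distParam (c : ℝ) (G : RMap) : ℝ≥0∞ :=
  ⨆ K ∈ G.pieces, distortion (quadFactor c G K) ((fun x => (x - c) ^ 2) '' pts K)

end BoxMap

end

/-!
Let `I ⊂ J` be the central interval of `g`, let `H` be the pre-renormalization of `g`, and write
`g = h ∘ φ` on `I`. A diffeomorphism with non-positive Schwarzian derivative has a convex
`|f'| ^ (-1/2)`, so its inverse does not increase Poincaré lengths. Pulled back along the first
return itinerary, this places the image under `g` of a piece of `H` well inside a non-central piece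
of `g`, unless the piece returns at once; the square root in `φ` then gives a square root of
lengths.

At a non-central return of `H` the image of its next central interval is well inside a non-central
piece `V`, made up of points at distance `a` to `b` from `c`. Hence the square of the next scaling
factor is `O(|V| / (r - b))` times the scaling factor of `H`, where `r` is the radius of `I`. If
the gap between `V` and `∂I` is comparable with `r`, then this ratio is `O(λ*)`, and it is
`O(exp (-y))`, where the gap between `V` and the central interval has asymmetric Poincaré length
`x + y / 2`; the scaling factor of `H` is at most `exp (-x)`. The first two estimates correspond to
`y / 2 ≤ ε K` and `y / 2 ≥ ε K`. If the outer gap is small, then `V` does not return at once, so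
its image lies well inside a non-central piece of `g`, and the ratio is `O(μ λ*)` with the
parameters of `g`: this is the third estimate.
-/

namespace BoxMap

open Set

section Convexity

variable {f w : ℝ → ℝ} {a b : ℝ} (hf : ContinuousOn f (Icc a b)) (hw : ConvexOn ℝ (Icc a b) w)
  (hpos : ∀ t ∈ Icc a b, 0 < w t) (hd : ∀ t ∈ Ioo a b, HasDerivAt f (1 / w t ^ 2) t)

theorem hasDerivAt_sub_div_mul_affine {A m x s : ℝ} (hA : A ≠ 0) (hs : A + m * (s - x) ≠ 0) :
    HasDerivAt (fun s => (s - x) / (A * (A + m * (s - x)))) (1 / (A + m * (s - x)) ^ 2) s := by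
  have hnum : HasDerivAt (fun s => s - x) 1 s := (hasDerivAt_id' s).sub_const x
  refine (hnum.div (((hnum.const_mul m).const_add A).const_mul A)
    (mul_ne_zero hA hs)).congr_deriv ?_
  field_simp
  ring

theorem le_chord_of_convexOn {S : Set ℝ} {m x y s : ℝ} (hw : ConvexOn ℝ S w) (hx : x ∈ S)
    (hy : y ∈ S) (hxy : x < y) (hs : s ∈ Icc x y) (hm : w y = w x + m * (y - x)) :
    w s ≤ w x + m * (s - x) := by
  rcases hs.1.eq_or_lt with rfl | hxs
  · simp
  have hsS : s ∈ S := hw.1.ordConnected.out hx hy hs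
  have hslope := hw.secant_mono hx hsS hy hxs.ne' hxy.ne' hs.2
  rw [hm, add_sub_cancel_left, mul_div_cancel_right₀ _ (sub_pos.2 hxy).ne',
    div_le_iff₀ (sub_pos.2 hxs)] at hslope
  linarith

include hf hw hpos hd

/-- Compare `f` with the primitive of `1 / l ^ 2`, where `l ≥ w` is the chord of `w`. -/
theorem div_mul_le_sub_of_convexOn {x y : ℝ} (hx : a ≤ x) (hxy : x < y) (hy : y ≤ b) :
    (y - x) / (w x * w y) ≤ f y - f x := by
  have hsub : Icc x y ⊆ Icc a b := Icc_subset_Icc hx hy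
  have hx' : x ∈ Icc a b := hsub (left_mem_Icc.2 hxy.le)
  have hy' : y ∈ Icc a b := hsub (right_mem_Icc.2 hxy.le)
  obtain ⟨m, hm⟩ : ∃ m, w y = w x + m * (y - x) :=
    ⟨(w y - w x) / (y - x), by rw [div_mul_cancel₀ _ (sub_pos.2 hxy).ne']; ring⟩
  have hchord : ∀ s ∈ Icc x y, w s ≤ w x + m * (s - x) := fun s hs =>
    le_chord_of_convexOn hw hx' hy' hxy hs hm
  have hlpos : ∀ s ∈ Icc x y, 0 < w x + m * (s - x) := fun s hs =>
    (hpos s (hsub hs)).trans_le (hchord s hs)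
  have hT : ∀ s ∈ Icc x y, HasDerivAt (fun s => (s - x) / (w x * (w x + m * (s - x))))
      (1 / (w x + m * (s - x)) ^ 2) s := fun s hs =>
    hasDerivAt_sub_div_mul_affine (hpos x hx').ne' (hlpos s hs).ne'
  have hD : ∀ s ∈ Ioo x y, HasDerivAt (fun s => f s - (s - x) / (w x * (w x + m * (s - x))))
      (1 / w s ^ 2 - 1 / (w x + m * (s - x)) ^ 2) s := fun s hs =>
    (hd s ⟨hx.trans_lt hs.1, hs.2.trans_le hy⟩).sub (hT s (Ioo_subset_Icc_self hs))
  have hmono : MonotoneOn (fun s => f s - (s - x) / (w x * (w x + m * (s - x)))) (Icc x y) := by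
    refine monotoneOn_of_hasDerivWithinAt_nonneg (convex_Icc x y)
      ((hf.mono hsub).sub fun s hs => (hT s hs).continuousAt.continuousWithinAt)
      (fun s hs => (hD s (interior_Icc (a := x) ▸ hs)).hasDerivWithinAt) fun s hs => ?_
    have hs : s ∈ Icc x y := interior_subset hs
    have := hpos s (hsub hs)
    have := hchord s hs
    rw [sub_nonneg]
    gcongr
  have := hmono (left_mem_Icc.2 hxy.le) (right_mem_Icc.2 hxy.le) hxy.le
  simp only [sub_self, zero_div, sub_zero, ← hm] at this
  linarith

theorem strictMonoOn_of_convexOn : StrictMonoOn f (Icc a b) := by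
  intro s hs t ht hst
  have hws := hpos s hs
  have hwt := hpos t ht
  exact sub_pos.1 ((div_pos (sub_pos.2 hst) (mul_pos hws hwt)).trans_le
    (div_mul_le_sub_of_convexOn hf hw hpos hd hs.1 hst ht.2))

theorem monotoneOn_kernel_of_convexOn {t : ℝ} (ht : t ≤ b) :
    MonotoneOn (fun s => 1 / (t - s) - 1 / w t ^ 2 / (f t - f s)) (Ico a t) := by
  have hlt := strictMonoOn_of_convexOn hf hw hpos hd
  have hmem : ∀ s ∈ Ico a t, s ∈ Icc a b ∧ t ∈ Icc a b ∧ t - s ≠ 0 ∧ f t - f s ≠ 0 := by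
    intro s hs
    have hs' : s ∈ Icc a b := ⟨hs.1, hs.2.le.trans ht⟩
    have ht' : t ∈ Icc a b := ⟨hs.1.trans hs.2.le, ht⟩
    exact ⟨hs', ht', (sub_pos.2 hs.2).ne', (sub_pos.2 (hlt hs' ht' hs.2)).ne'⟩
  have hder : ∀ s ∈ Ioo a t, HasDerivAt (fun s => 1 / (t - s) - 1 / w t ^ 2 / (f t - f s))
      (1 / (t - s) ^ 2 - 1 / w t ^ 2 * (1 / w s ^ 2) / (f t - f s) ^ 2) s := by
    intro s hs
    obtain ⟨-, -, h1, h2⟩ := hmem s (Ioo_subset_Ico_self hs)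
    have hts : HasDerivAt (fun s => t - s) (-1) s := (hasDerivAt_id' s).const_sub t
    have hfts : HasDerivAt (fun s => f t - f s) (-(1 / w s ^ 2)) s :=
      (hd s ⟨hs.1, hs.2.trans_le ht⟩).const_sub (f t)
    refine (((hasDerivAt_const s (1 : ℝ)).div hts h1).sub
      ((hasDerivAt_const s (1 / w t ^ 2)).div hfts h2)).congr_deriv ?_
    ring
  refine monotoneOn_of_hasDerivWithinAt_nonneg (convex_Ico a t) ?_
    (fun s hs => (hder s (interior_Ico (a := a) ▸ hs)).hasDerivWithinAt) fun s hs => ?_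
  · refine ContinuousOn.sub ?_ ?_
    · exact continuousOn_const.div (by fun_prop) fun s hs => (hmem s hs).2.2.1
    · exact continuousOn_const.div (continuousOn_const.sub (hf.mono fun s hs => (hmem s hs).1))
        fun s hs => (hmem s hs).2.2.2
  · have hs' : s ∈ Ico a t := interior_subset hs
    have hst : 0 < t - s := sub_pos.2 hs'.2
    have hws := hpos s (hmem s hs').1
    have hwt := hpos t (hmem s hs').2.1
    rw [sub_nonneg]
    calc 1 / w t ^ 2 * (1 / w s ^ 2) / (f t - f s) ^ 2
        ≤ 1 / w t ^ 2 * (1 / w s ^ 2) / ((t - s) / (w s * w t)) ^ 2 := by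
          gcongr
          exact div_mul_le_sub_of_convexOn hf hw hpos hd hs'.1 hs'.2 ht
      _ = 1 / (t - s) ^ 2 := by field_simp

theorem antitoneOn_logRatio_of_convexOn {p x : ℝ} (hp : a ≤ p) (hpx : p < x) :
    AntitoneOn (fun t => Real.log (t - p) - Real.log (t - x) -
      (Real.log (f t - f p) - Real.log (f t - f x))) (Ioc x b) := by
  have hlt := strictMonoOn_of_convexOn hf hw hpos hd
  have hne : ∀ s ∈ Icc p x, ∀ t ∈ Ioc x b, t - s ≠ 0 ∧ f t - f s ≠ 0 := fun s hs t ht =>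
    ⟨(sub_pos.2 (hs.2.trans_lt ht.1)).ne', (sub_pos.2 (hlt ⟨hp.trans hs.1, by linarith [hs.2, ht.1,
      ht.2]⟩ ⟨by linarith [ht.1], ht.2⟩ (hs.2.trans_lt ht.1))).ne'⟩
  have mp : p ∈ Icc p x := left_mem_Icc.2 hpx.le
  have mx : x ∈ Icc p x := right_mem_Icc.2 hpx.le
  have hfc : ContinuousOn f (Ioc x b) :=
    hf.mono fun t ht => ⟨by linarith [ht.1], ht.2⟩
  have hder : ∀ t ∈ Ioo x b, HasDerivAt (fun t => Real.log (t - p) - Real.log (t - x) -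
      (Real.log (f t - f p) - Real.log (f t - f x))) (1 / (t - p) - 1 / (t - x) -
        (1 / w t ^ 2 / (f t - f p) - 1 / w t ^ 2 / (f t - f x))) t := by
    intro t ht
    have hft := hd t ⟨by linarith [ht.1], ht.2⟩
    have hid := hasDerivAt_id' t
    have h1 := hne p mp t (Ioo_subset_Ioc_self ht)
    have h2 := hne x mx t (Ioo_subset_Ioc_self ht)
    exact (((hid.sub_const p).log h1.1).sub ((hid.sub_const x).log h2.1)).sub
      (((hft.sub_const (f p)).log h1.2).sub ((hft.sub_const (f x)).log h2.2))
  refine antitoneOn_of_hasDerivWithinAt_nonpos (convex_Ioc x b) ?_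
    (fun t ht => (hder t (interior_Ioc (a := x) ▸ ht)).hasDerivWithinAt) fun t ht => ?_
  · refine ContinuousOn.sub (ContinuousOn.sub ?_ ?_) (ContinuousOn.sub ?_ ?_)
    · exact ContinuousOn.log (by fun_prop) fun t ht => (hne p mp t ht).1
    · exact ContinuousOn.log (by fun_prop) fun t ht => (hne x mx t ht).1
    · exact ContinuousOn.log (by fun_prop) fun t ht => (hne p mp t ht).2
    · exact ContinuousOn.log (by fun_prop) fun t ht => (hne x mx t ht).2
  · have ht : t ∈ Ioc x b := interior_subset ht
    have := monotoneOn_kernel_of_convexOn hf hw hpos hd ht.2 ⟨hp, hpx.trans ht.1⟩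
      ⟨hp.trans hpx.le, ht.1⟩ hpx.le
    simp only at this
    linarith

theorem cross_of_convexOn {p x y q : ℝ} (hp : a ≤ p) (hpx : p ≤ x) (hxy : x ≤ y) (hyq : y ≤ q)
    (hq : q ≤ b) :
    (y - x) * (q - p) * ((f x - f p) * (f q - f y)) ≤
      (f y - f x) * (f q - f p) * ((x - p) * (q - y)) := by
  rcases hpx.eq_or_lt with rfl | hpx
  · simp
  rcases hyq.eq_or_lt with rfl | hyq
  · simp
  rcases hxy.eq_or_lt with rfl | hxy
  · simp
  have hlt : ∀ {s t}, a ≤ s → s < t → t ≤ b → 0 < f t - f s := fun hs hst ht =>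
    sub_pos.2 (strictMonoOn_of_convexOn hf hw hpos hd ⟨hs, hst.le.trans ht⟩
      ⟨hs.trans hst.le, ht⟩ hst)
  have hqp : 0 < q - p := by linarith
  have hqx : 0 < q - x := by linarith
  have hyp : 0 < y - p := by linarith
  have : 0 < y - x := by linarith
  have hfqp : 0 < f q - f p := hlt hp (by linarith) hq
  have hfqx : 0 < f q - f x := hlt (by linarith) (by linarith) hq
  have hfyp : 0 < f y - f p := hlt hp (by linarith) (by linarith)
  have hfyx : 0 < f y - f x := hlt (by linarith) hxy (by linarith)
  have hanti := antitoneOn_logRatio_of_convexOn hf hw hpos hd hp hpx ⟨hxy, hyq.le.trans hq⟩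
    ⟨hxy.trans hyq, hq⟩ hyq.le
  have hlog : Real.log ((q - p) * (f q - f x) * ((y - x) * (f y - f p))) ≤
      Real.log ((q - x) * (f q - f p) * ((y - p) * (f y - f x))) := by
    rw [Real.log_mul (by positivity) (by positivity), Real.log_mul (by positivity) (by positivity),
      Real.log_mul (by positivity) (by positivity), Real.log_mul (by positivity) (by positivity),
      Real.log_mul (by positivity) (by positivity), Real.log_mul (by positivity) (by positivity)]
    simp only at hanti
    linarith
  linear_combination (Real.log_le_log_iff (by positivity) (by positivity)).1 hlog

end Convexity

section CrossRatio

/-- A strictly monotone differentiable branch on `[a, b]` with non-vanishing derivative which does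
not increase the cross ratios `|[p, x]| |[y, q]| / (|[x, y]| |[p, q]|)`; equivalently, its inverse
does not increase Poincaré lengths. This is all that is used about the sign of the Schwarzian
derivative, and unlike `IsSDiffeo` it needs no third derivative. -/
structure CrossDiffeo (f : ℝ → ℝ) (a b : ℝ) : Prop where
  lt : a < b
  hasDeriv : ∀ x ∈ Icc a b, ∃ d, d ≠ 0 ∧ HasDerivWithinAt f d (Icc a b) x
  mono : StrictMonoOn f (Icc a b) ∨ StrictAntiOn f (Icc a b)
  cross : ∀ p x y q, a ≤ p → p ≤ x → x ≤ y → y ≤ q → q ≤ b →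
    (y - x) * (q - p) * ((f x - f p) * (f q - f y)) ≤
      (f y - f x) * (f q - f p) * ((x - p) * (q - y))

theorem hasDerivAt_iteratedDeriv {f : ℝ → ℝ} {x : ℝ} {n : ℕ} (hf : ContDiffAt ℝ (n + 1) f x) :
    HasDerivAt (iteratedDeriv n f) (iteratedDeriv (n + 1) f x) x := by
  rw [iteratedDeriv_succ, hasDerivAt_deriv_iff, iteratedDeriv_eq_equiv_comp]
  exact (LinearIsometryEquiv.differentiable _).differentiableAt.comp x
    ((hf.iteratedFDeriv_right (i := n) (m := 1) (by rw [add_comm])).differentiableAt one_ne_zero)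

theorem hasDerivAt_deriv_rpow {f : ℝ → ℝ} {x : ℝ} (hf : ContDiffAt ℝ 2 f x) (h0 : 0 < deriv f x) :
    HasDerivAt (fun y => deriv f y ^ (-(1 / 2) : ℝ))
      (-(1 / 2) * deriv f x ^ (-(3 / 2) : ℝ) * iteratedDeriv 2 f x) x := by
  have hD1 : HasDerivAt (deriv f) (iteratedDeriv 2 f x) x := by
    simpa only [iteratedDeriv_one] using hasDerivAt_iteratedDeriv (n := 1) hf
  refine (hD1.rpow_const (p := -(1 / 2)) (Or.inl h0.ne')).congr_deriv ?_
  norm_num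
  ring

theorem hasDerivAt_deriv_rpow_mul_iteratedDeriv {f : ℝ → ℝ} {x : ℝ} (hf : ContDiffAt ℝ 3 f x)
    (h0 : 0 < deriv f x) :
    HasDerivAt (fun y => -(1 / 2) * deriv f y ^ (-(3 / 2) : ℝ) * iteratedDeriv 2 f y)
      (-(1 / 2) * deriv f x ^ (-(1 / 2) : ℝ) * schwarzian f x) x := by
  have hD1 : HasDerivAt (deriv f) (iteratedDeriv 2 f x) x := by
    simpa only [iteratedDeriv_one] using
      hasDerivAt_iteratedDeriv (n := 1) (hf.of_le (by norm_num))
  have hD2 : HasDerivAt (iteratedDeriv 2 f) (iteratedDeriv 3 f x) x :=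
    hasDerivAt_iteratedDeriv (n := 2) hf
  refine (((hD1.rpow_const (p := -(3 / 2)) (Or.inl h0.ne')).const_mul
    (-(1 / 2))).mul hD2).congr_deriv ?_
  have e1 : deriv f x ^ (-(3 / 2) : ℝ) = deriv f x ^ (-(1 / 2) : ℝ) / deriv f x := by
    rw [← Real.rpow_sub_one h0.ne']
    norm_num
  have e2 : deriv f x ^ (-(3 / 2) - 1 : ℝ) = deriv f x ^ (-(1 / 2) : ℝ) / deriv f x ^ 2 := by
    rw [Real.rpow_sub_one h0.ne', e1]
    field_simp
  rw [e1, e2, schwarzian]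
  field_simp
  ring

theorem convexOn_derivWithin_rpow {f : ℝ → ℝ} {a b : ℝ} (hab : a < b)
    (hs : ContDiffOn ℝ 3 f (Icc a b)) (hpos : ∀ x ∈ Icc a b, 0 < derivWithin f (Icc a b) x)
    (hS : ∀ x ∈ Ioo a b, schwarzian f x ≤ 0) :
    ConvexOn ℝ (Icc a b) (fun x => derivWithin f (Icc a b) x ^ (-(1 / 2) : ℝ)) := by
  have hEq : ∀ x ∈ Ioo a b, derivWithin f (Icc a b) x = deriv f x := fun x hx =>
    derivWithin_of_mem_nhds (Icc_mem_nhds hx.1 hx.2)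
  have hne : ∀ x ∈ Ioo a b, 0 < deriv f x := fun x hx => hEq x hx ▸ hpos x (Ioo_subset_Icc_self hx)
  have hat : ∀ x ∈ Ioo a b, ContDiffAt ℝ 3 f x := fun x hx =>
    hs.contDiffAt (Icc_mem_nhds hx.1 hx.2)
  refine convexOn_of_hasDerivWithinAt2_nonneg (convex_Icc a b)
    (f' := fun x => -(1 / 2) * deriv f x ^ (-(3 / 2) : ℝ) * iteratedDeriv 2 f x)
    (f'' := fun x => -(1 / 2) * deriv f x ^ (-(1 / 2) : ℝ) * schwarzian f x) ?_ ?_ ?_ ?_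
  · exact (hs.continuousOn_derivWithin (uniqueDiffOn_Icc hab) (by norm_num)).rpow_const
      fun x hx => Or.inl (hpos x hx).ne'
  all_goals
    rw [interior_Icc]
    intro x hx
  · exact (hasDerivAt_deriv_rpow ((hat x hx).of_le (by norm_num)) (hne x hx)).hasDerivWithinAt.congr
      (fun y hy => by rw [hEq y hy]) (by rw [hEq x hx])
  · exact (hasDerivAt_deriv_rpow_mul_iteratedDeriv (hat x hx) (hne x hx)).hasDerivWithinAt
  · have := Real.rpow_pos_of_pos (hne x hx) (-(1 / 2) : ℝ)
    nlinarith [hS x hx]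

theorem CrossDiffeo.of_derivWithin_pos {f : ℝ → ℝ} {a b : ℝ} (hab : a < b)
    (hs : ContDiffOn ℝ 3 f (Icc a b)) (hpos : ∀ x ∈ Icc a b, 0 < derivWithin f (Icc a b) x)
    (hS : ∀ x ∈ Ioo a b, schwarzian f x ≤ 0) : CrossDiffeo f a b := by
  have hw := convexOn_derivWithin_rpow hab hs hpos hS
  have hwpos : ∀ t ∈ Icc a b, 0 < derivWithin f (Icc a b) t ^ (-(1 / 2) : ℝ) := fun t ht =>
    Real.rpow_pos_of_pos (hpos t ht) _
  have hderiv : ∀ t ∈ Icc a b, HasDerivWithinAt f (derivWithin f (Icc a b) t) (Icc a b) t :=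
    fun t ht => (hs.differentiableOn (by norm_num) t ht).hasDerivWithinAt
  have hd : ∀ t ∈ Ioo a b,
      HasDerivAt f (1 / (derivWithin f (Icc a b) t ^ (-(1 / 2) : ℝ)) ^ 2) t := by
    intro t ht
    refine ((hderiv t (Ioo_subset_Icc_self ht)).hasDerivAt
      (Icc_mem_nhds ht.1 ht.2)).congr_deriv ?_
    rw [← Real.rpow_natCast, ← Real.rpow_mul (hpos t (Ioo_subset_Icc_self ht)).le]
    norm_num [Real.rpow_neg_one]
  exact
    { lt := hab
      hasDeriv := fun x hx => ⟨_, (hpos x hx).ne', hderiv x hx⟩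
      mono := .inl (strictMonoOn_of_convexOn hs.continuousOn hw hwpos hd)
      cross := fun _ _ _ _ => cross_of_convexOn hs.continuousOn hw hwpos hd }

theorem CrossDiffeo.of_neg {f : ℝ → ℝ} {a b : ℝ} (h : CrossDiffeo (fun x => -f x) a b) :
    CrossDiffeo f a b where
  lt := h.lt
  hasDeriv x hx := by
    obtain ⟨d, hd, h'⟩ := h.hasDeriv x hx
    exact ⟨-d, neg_ne_zero.2 hd, by simpa using h'.fun_neg⟩
  mono := h.mono.symm.imp (fun h x hx y hy hxy => neg_lt_neg_iff.1 (h hx hy hxy))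
    fun h x hx y hy hxy => neg_lt_neg_iff.1 (h hx hy hxy)
  cross p x y q h1 h2 h3 h4 h5 := by
    linarith [h.cross p x y q h1 h2 h3 h4 h5]

theorem schwarzian_neg (f : ℝ → ℝ) (x : ℝ) : schwarzian (fun x => -f x) x = schwarzian f x := by
  simp only [schwarzian, iteratedDeriv_fun_neg, deriv.fun_neg, neg_div_neg_eq]

theorem IsSDiffeo.crossDiffeo {f : ℝ → ℝ} {a b : ℝ} (hab : a < b) (h : IsSDiffeo f a b) :
    CrossDiffeo f a b := by
  have hc : ContinuousOn (derivWithin f (Icc a b)) (Icc a b) :=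
    h.smooth.continuousOn_derivWithin (uniqueDiffOn_Icc hab) (by norm_num)
  have hsign : (∀ x ∈ Icc a b, 0 < derivWithin f (Icc a b) x) ∨
      (∀ x ∈ Icc a b, derivWithin f (Icc a b) x < 0) := by
    by_contra! hcon
    obtain ⟨⟨x, hx, hx'⟩, y, hy, hy'⟩ := hcon
    obtain ⟨z, hz, hz'⟩ := isPreconnected_Icc.intermediate_value hx hy hc ⟨hx', hy'⟩
    exact h.deriv_ne z hz hz'
  rcases hsign with hs | hs
  · exact .of_derivWithin_pos hab h.smooth hs h.schwarz
  · refine .of_neg (.of_derivWithin_pos hab h.smooth.neg (fun x hx => ?_) fun x hx => ?_)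
    · rw [derivWithin.fun_neg]
      exact neg_pos.2 (hs x hx)
    · exact (schwarzian_neg f x).trans_le (h.schwarz x hx)

namespace CrossDiffeo

variable {f g : ℝ → ℝ} {a b a' b' : ℝ}

theorem continuousOn (h : CrossDiffeo f a b) : ContinuousOn f (Icc a b) := fun x hx =>
  let ⟨_, _, hd⟩ := h.hasDeriv x hx
  hd.continuousWithinAt

theorem injOn (h : CrossDiffeo f a b) : InjOn f (Icc a b) :=
  h.mono.elim StrictMonoOn.injOn StrictAntiOn.injOn

theorem id (hab : a < b) : CrossDiffeo id a b where
  lt := hab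
  hasDeriv x _ := ⟨1, one_ne_zero, hasDerivWithinAt_id x _⟩
  mono := .inl strictMonoOn_id
  cross _ _ _ _ _ _ _ _ _ := le_rfl

theorem mem_uIcc_iff (h : CrossDiffeo f a b) {u v z : ℝ} (hu : u ∈ Icc a b) (hv : v ∈ Icc a b)
    (hz : z ∈ Icc a b) : f z ∈ uIcc (f u) (f v) ↔ z ∈ uIcc u v := by
  simp only [mem_uIcc]
  rcases h.mono with hm | hm
  · simp only [hm.le_iff_le hu hz, hm.le_iff_le hz hv, hm.le_iff_le hv hz, hm.le_iff_le hz hu]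
  · simp only [hm.le_iff_ge hu hz, hm.le_iff_ge hz hv, hm.le_iff_ge hv hz, hm.le_iff_ge hz hu]
    tauto

theorem restrict (h : CrossDiffeo f a b) (ha : a ≤ a') (hab : a' < b') (hb : b' ≤ b) :
    CrossDiffeo f a' b' where
  lt := hab
  hasDeriv x hx :=
    let ⟨d, h0, hd⟩ := h.hasDeriv x (Icc_subset_Icc ha hb hx)
    ⟨d, h0, hd.mono (Icc_subset_Icc ha hb)⟩
  mono := h.mono.imp (fun h => h.mono (Icc_subset_Icc ha hb)) fun h => h.mono (Icc_subset_Icc ha hb)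
  cross p x y q h1 h2 h3 h4 h5 := h.cross p x y q (ha.trans h1) h2 h3 h4 (h5.trans hb)

theorem congr (h : CrossDiffeo f a b) (e : EqOn g f (Icc a b)) : CrossDiffeo g a b where
  lt := h.lt
  hasDeriv x hx :=
    let ⟨d, h0, hd⟩ := h.hasDeriv x hx
    ⟨d, h0, hd.congr e (e hx)⟩
  mono := h.mono.imp (fun h => h.congr e.symm) fun h => h.congr e.symm
  cross p x y q h1 h2 h3 h4 h5 := by
    rw [e ⟨h1, by linarith⟩, e ⟨h1.trans h2, by linarith⟩, e ⟨by linarith, h4.trans h5⟩,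
      e ⟨by linarith, h5⟩]
    exact h.cross p x y q h1 h2 h3 h4 h5

theorem sub_mul_sub_pos (h : CrossDiffeo f a b) {p x y q : ℝ} (hp : p ∈ Icc a b) (hx : x ∈ Icc a b)
    (hy : y ∈ Icc a b) (hq : q ∈ Icc a b) (hpx : p < x) (hyq : y < q) :
    0 < (f x - f p) * (f q - f y) := by
  rcases h.mono with hm | hm
  · exact mul_pos (sub_pos.2 (hm hp hx hpx)) (sub_pos.2 (hm hy hq hyq))
  · exact mul_pos_of_neg_of_neg (sub_neg.2 (hm hp hx hpx)) (sub_neg.2 (hm hy hq hyq))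

theorem cross_of_le_or_ge (h : CrossDiffeo f a b) {p x y q : ℝ} (hp : p ∈ Icc a b)
    (hq : q ∈ Icc a b) (hle : p ≤ x ∧ x ≤ y ∧ y ≤ q ∨ q ≤ y ∧ y ≤ x ∧ x ≤ p) :
    (y - x) * (q - p) * ((f x - f p) * (f q - f y)) ≤
      (f y - f x) * (f q - f p) * ((x - p) * (q - y)) := by
  rcases hle with ⟨hpx, hxy, hyq⟩ | ⟨hqy, hyx, hxp⟩
  · exact h.cross p x y q hp.1 hpx hxy hyq hq.2
  · linarith [h.cross q y x p hq.1 hqy hyx hxp hp.2]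

theorem cross_comp (hg : CrossDiffeo g a' b') (hf : CrossDiffeo f a b)
    (hm : MapsTo f (Icc a b) (Icc a' b')) {p x y q : ℝ} (hp : a ≤ p) (hpx : p < x) (hxy : x ≤ y)
    (hyq : y < q) (hq : q ≤ b) :
    (y - x) * (q - p) * ((g (f x) - g (f p)) * (g (f q) - g (f y))) ≤
      (g (f y) - g (f x)) * (g (f q) - g (f p)) * ((x - p) * (q - y)) := by
  have mp : p ∈ Icc a b := ⟨hp, by linarith⟩
  have mx : x ∈ Icc a b := ⟨by linarith, by linarith⟩
  have my : y ∈ Icc a b := ⟨by linarith, by linarith⟩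
  have mq : q ∈ Icc a b := ⟨by linarith, hq⟩
  have crossf := hf.cross p x y q hp hpx.le hxy hyq.le hq
  have crossg := hg.cross_of_le_or_ge (hm mp) (hm mq) (hf.mono.imp
    (fun h => ⟨(h mp mx hpx).le, h.monotoneOn mx my hxy, (h my mq hyq).le⟩)
    fun h => ⟨(h my mq hyq).le, h.antitoneOn mx my hxy, (h mp mx hpx).le⟩)
  have pos : 0 < (g (f x) - g (f p)) * (g (f q) - g (f y)) := by
    rcases hf.mono with h | h
    · exact hg.sub_mul_sub_pos (hm mp) (hm mx) (hm my) (hm mq) (h mp mx hpx) (h my mq hyq)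
    · linarith [hg.sub_mul_sub_pos (hm mx) (hm mp) (hm mq) (hm my) (h mp mx hpx) (h my mq hyq)]
  have : 0 ≤ (x - p) * (q - y) := mul_nonneg (by linarith) (by linarith)
  refine le_of_mul_le_mul_right ?_ (hf.sub_mul_sub_pos mp mx my mq hpx hyq)
  linarith [mul_le_mul_of_nonneg_right crossf pos.le, mul_le_mul_of_nonneg_right crossg this]

theorem comp (hg : CrossDiffeo g a' b') (hf : CrossDiffeo f a b)
    (hm : MapsTo f (Icc a b) (Icc a' b')) : CrossDiffeo (g ∘ f) a b where
  lt := hf.lt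
  hasDeriv x hx :=
    let ⟨d, h0, hd⟩ := hf.hasDeriv x hx
    let ⟨e, h1, he⟩ := hg.hasDeriv (f x) (hm hx)
    ⟨e * d, mul_ne_zero h1 h0, he.comp x hd hm⟩
  mono := by
    rcases hf.mono with h | h <;> rcases hg.mono with h' | h'
    · exact Or.inl (h'.comp h hm)
    · exact Or.inr (h'.comp_strictMonoOn h hm)
    · exact Or.inr (h'.comp_strictAntiOn h hm)
    · exact Or.inl (h'.comp h hm)
  cross p x y q hp hpx hxy hyq hq := by
    rcases hpx.eq_or_lt with rfl | hpx
    · simp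
    rcases hyq.eq_or_lt with rfl | hyq
    · simp
    exact cross_comp hg hf hm hp hpx hxy hyq hq

theorem sq_sub {c : ℝ} (hab : a < b) (hc : c < a ∨ b < c) :
    CrossDiffeo (fun x => (x - c) ^ 2) a b where
  lt := hab
  hasDeriv x hx := by
    refine ⟨2 * (x - c), mul_ne_zero two_ne_zero (sub_ne_zero.2 ?_),
      (((hasDerivAt_id' x).sub_const c).pow 2).hasDerivWithinAt.congr_deriv (by simp)⟩
    rintro rfl
    exact hc.elim hx.1.not_gt hx.2.not_gt
  mono := hc.imp
    (fun hca x hx y _ hxy => by simp only; nlinarith [hx.1])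
    (fun hbc x _ y hy hxy => by simp only; nlinarith [hy.2])
  cross p x y q _ hpx hxy hyq _ := by
    have h : 0 ≤ (y - x) * (q - p) * ((x - p) * (q - y)) * ((q - x) * (y - p)) := by
      have : 0 ≤ y - x := by linarith
      have : 0 ≤ q - p := by linarith
      have : 0 ≤ x - p := by linarith
      have : 0 ≤ q - y := by linarith
      have : 0 ≤ q - x := by linarith
      have : 0 ≤ y - p := by linarith
      positivity
    linear_combination h

end CrossDiffeo

end CrossRatio

section Order

variable {d₀ d₁ x y z : ℝ}

theorem Icc_subset_uIcc_of_notMem (hz : z ∈ uIcc x y) (hzd : z ∈ Icc d₀ d₁)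
    (hx : x ∉ Icc d₀ d₁) (hy : y ∉ Icc d₀ d₁) : Icc d₀ d₁ ⊆ uIcc x y := by
  intro w hw
  simp only [mem_uIcc, mem_Icc, not_and_or, not_le] at *
  grind

theorem exists_endpoint_mem_uIcc_of_notMem (hx : x ∈ Icc d₀ d₁) (hy : y ∉ Icc d₀ d₁) :
    ∃ d, (d = d₀ ∨ d = d₁) ∧ d ∈ uIcc x y ∧ ∀ w ∈ uIcc x y, w ∈ Icc d₀ d₁ ↔ w ∈ uIcc x d := by
  rcases lt_or_ge d₁ y with hd | hd
  · refine ⟨d₁, .inr rfl, ?_, fun w => ?_⟩ <;>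
      rw [uIcc_of_le (hx.2.trans hd.le)]
    · exact ⟨hx.2, hd.le⟩
    · rw [uIcc_of_le hx.2]
      exact fun hw => ⟨fun h => ⟨hw.1, h.2⟩, fun h => ⟨hx.1.trans h.1, h.2⟩⟩
  · have hd : y < d₀ := not_le.1 fun h => hy ⟨h, hd⟩
    refine ⟨d₀, .inl rfl, ?_, fun w => ?_⟩ <;>
      rw [uIcc_of_ge (hd.le.trans hx.1)]
    · exact ⟨hd.le, hx.1⟩
    · rw [uIcc_of_ge hx.1]
      exact fun hw => ⟨fun h => ⟨h.1, hw.2⟩, fun h => ⟨h.1, h.2.trans hx.2⟩⟩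

end Order

namespace CrossDiffeo

variable {f : ℝ → ℝ} {a b x : ℝ} {D : Seg}

theorem image_Icc (h : CrossDiffeo f a b) : f '' Icc a b = uIcc (f a) (f b) := by
  refine (image_subset_iff.2 fun z hz => ?_).antisymm ?_
  · rw [← uIcc_of_le h.lt.le] at hz
    exact (h.mem_uIcc_iff (left_mem_Icc.2 h.lt.le) (right_mem_Icc.2 h.lt.le)
      (uIcc_of_le h.lt.le ▸ hz)).2 hz
  · have hc := h.continuousOn
    rw [← uIcc_of_le h.lt.le] at hc ⊢
    exact intermediate_value_uIcc hc

theorem endpoints (h : CrossDiffeo f a b) (hi : f '' Icc a b = pts D) :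
    (f a = D.fst ∧ f b = D.snd) ∨ (f a = D.snd ∧ f b = D.fst) := by
  rw [h.image_Icc, pts] at hi
  rcases le_total (f a) (f b) with hab | hab
  · rw [uIcc_of_le hab, Icc_eq_Icc_iff hab] at hi
    exact .inl hi
  · rw [uIcc_of_ge hab, Icc_eq_Icc_iff hab] at hi
    exact .inr hi.symm

theorem exists_pullback (h : CrossDiffeo f a b) (hD : D.fst < D.snd) (ha : f a ∉ pts D)
    (hb : f b ∉ pts D) (hx : x ∈ Icc a b) (hfx : f x ∈ pts D) :
    ∃ K : Seg, a < K.fst ∧ K.fst < K.snd ∧ K.snd < b ∧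
      pts K = {z ∈ Icc a b | f z ∈ pts D} ∧ f '' pts K = pts D := by
  have hsub : pts D ⊆ f '' Icc a b := by
    rw [h.image_Icc]
    exact Icc_subset_uIcc_of_notMem (h.image_Icc ▸ mem_image_of_mem f hx) hfx ha hb
  obtain ⟨u, hu, hfu⟩ := hsub (left_mem_Icc.2 D.fst_le_snd)
  obtain ⟨v, hv, hfv⟩ := hsub (right_mem_Icc.2 D.fst_le_snd)
  have hpts : uIcc u v = {z ∈ Icc a b | f z ∈ pts D} := by
    ext z
    have hmem (hz : z ∈ Icc a b) : f z ∈ pts D ↔ z ∈ uIcc u v := by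
      rw [pts, ← uIcc_of_le D.fst_le_snd, ← hfu, ← hfv, h.mem_uIcc_iff hu hv hz]
    have hz : z ∈ uIcc u v → z ∈ Icc a b := fun h => ordConnected_Icc.uIcc_subset hu hv h
    exact ⟨fun h => ⟨hz h, (hmem (hz h)).2 h⟩, fun h => (hmem h.1).1 h.2⟩
  have huv : u ≠ v := by
    rintro rfl
    exact hD.ne (hfu.symm.trans hfv)
  have hmin : u ⊓ v ∈ {z ∈ Icc a b | f z ∈ pts D} := hpts ▸ left_mem_Icc.2 inf_le_sup
  have hmax : u ⊔ v ∈ {z ∈ Icc a b | f z ∈ pts D} := hpts ▸ right_mem_Icc.2 inf_le_sup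
  refine ⟨⟨(u ⊓ v, u ⊔ v), inf_le_sup⟩, hmin.1.1.lt_of_ne ?_, inf_lt_sup.2 huv,
    hmax.1.2.lt_of_ne ?_, hpts, ?_⟩
  · exact fun e => ha (e ▸ hmin.2)
  · exact fun e => hb (e ▸ hmax.2)
  · change f '' uIcc u v = pts D
    rw [hpts]
    exact (image_inter_preimage f _ _).trans (inter_eq_right.2 hsub)

theorem exists_pullback_left (h : CrossDiffeo f a b) (ha : f a ∈ pts D) (hb : f b ∉ pts D) :
    ∃ t, a ≤ t ∧ t < b ∧ {z ∈ Icc a b | f z ∈ pts D} = Icc a t ∧ (f t = D.fst ∨ f t = D.snd) := by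
  have ma := left_mem_Icc.2 h.lt.le
  have mb := right_mem_Icc.2 h.lt.le
  obtain ⟨d, hd, hdab, hexit⟩ := exists_endpoint_mem_uIcc_of_notMem ha hb
  obtain ⟨t, ht, rfl⟩ : d ∈ f '' Icc a b := h.image_Icc ▸ hdab
  have hmem : ∀ z ∈ Icc a b, f z ∈ pts D ↔ z ∈ Icc a t := fun z hz => by
    rw [← uIcc_of_le ht.1, ← h.mem_uIcc_iff ma ht hz]
    exact hexit _ (h.image_Icc ▸ mem_image_of_mem f hz)
  refine ⟨t, ht.1, ht.2.lt_of_ne ?_, ?_, hd⟩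
  · rintro rfl
    exact hb ((hmem t mb).2 mb)
  · ext z
    exact ⟨fun hz => (hmem z hz.1).1 hz.2, fun hz =>
      have hz' : z ∈ Icc a b := ⟨hz.1, hz.2.trans ht.2⟩
      ⟨hz', (hmem z hz').2 hz⟩⟩

end CrossDiffeo

section Branches

/-- `K` is the interval `[c - r, c + r]`. -/
def IsCentered (c : ℝ) (K : Seg) (r : ℝ) : Prop := K.fst = c - r ∧ K.snd = c + r

/-- A central branch: over `K = [c - r, c + r]` the map `f` is `h ∘ φ`, `φ x = (x - c) ^ 2`; it
sends `K` into `J` and the end points of `K` to an end point of `J`. -/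
structure IsFoldBranch (c r : ℝ) (h f : ℝ → ℝ) (K J : Seg) : Prop where
  pos : 0 < r
  centered : IsCentered c K r
  diffeo : CrossDiffeo h 0 (r ^ 2)
  eq_comp : ∀ x ∈ pts K, f x = h ((x - c) ^ 2)
  critical_mem : h 0 ∈ pts J
  boundary : h (r ^ 2) = J.fst ∨ h (r ^ 2) = J.snd

/-- `f` has a central branch over `K`, for some radius and diffeomorphic factor. -/
def IsFold (c : ℝ) (f : ℝ → ℝ) (K J : Seg) : Prop := ∃ r h, IsFoldBranch c r h f K J

/-- A non-central branch: `f` maps `K` diffeomorphically onto `L`. -/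
def IsFullBranch (f : ℝ → ℝ) (K L : Seg) : Prop :=
  CrossDiffeo f K.fst K.snd ∧ f '' pts K = pts L

/-- The branch of a box map over a piece `K`, central or not. -/
def IsBranch (c : ℝ) (f : ℝ → ℝ) (K L : Seg) : Prop :=
  (c ∈ pts K → IsFold c f K L) ∧ (c ∉ pts K → IsFullBranch f K L)

variable {c r : ℝ} {f g h F : ℝ → ℝ} {D I J K L : Seg}

theorem IsCentered.mem_pts_iff (hK : IsCentered c K r) (hr : 0 ≤ r) {x : ℝ} :
    x ∈ pts K ↔ (x - c) ^ 2 ∈ Icc 0 (r ^ 2) := by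
  rw [mem_Icc, sq_le_sq, abs_of_nonneg hr, abs_le, pts, hK.1, hK.2, mem_Icc]
  constructor
  · exact fun hx => ⟨sq_nonneg _, by linarith, by linarith⟩
  · exact fun hx => ⟨by linarith, by linarith⟩

theorem IsCentered.len_eq (hK : IsCentered c K r) : len K = 2 * r := by
  rw [len, hK.1, hK.2]
  ring

theorem ordConnected_pts : OrdConnected (pts K) := ordConnected_Icc

theorem le_of_pts_subset (hKL : pts K ⊆ pts L) : K ≤ L :=
  ⟨(hKL (left_mem_Icc.2 K.fst_le_snd)).1, (hKL (right_mem_Icc.2 K.fst_le_snd)).2⟩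

theorem notMem_pts_of_boundary (hDJ : J.fst < D.fst ∧ D.snd < J.snd) {x : ℝ}
    (hx : x = J.fst ∨ x = J.snd) : x ∉ pts D := by
  rintro ⟨h1, h2⟩
  rcases hx with rfl | rfl
  · exact h1.not_gt hDJ.1
  · exact h2.not_gt hDJ.2

namespace IsFoldBranch

theorem mem (hf : IsFoldBranch c r h f K J) : c ∈ pts K :=
  (hf.centered.mem_pts_iff hf.pos.le).2 (by simp [sq_nonneg])

theorem mapsTo_sq (hf : IsFoldBranch c r h f K J) :
    MapsTo (fun x => (x - c) ^ 2) (pts K) (Icc 0 (r ^ 2)) := fun _ hx =>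
  (hf.centered.mem_pts_iff hf.pos.le).1 hx

theorem apply_critical (hf : IsFoldBranch c r h f K J) : f c = h 0 := by
  simpa using hf.eq_comp c hf.mem

theorem apply_boundary (hf : IsFoldBranch c r h f K J) {x : ℝ} (hx : x = K.fst ∨ x = K.snd) :
    x ∈ pts K ∧ (f x = J.fst ∨ f x = J.snd) := by
  have hxK : x ∈ pts K := by
    rcases hx with rfl | rfl
    exacts [left_mem_Icc.2 K.fst_le_snd, right_mem_Icc.2 K.fst_le_snd]
  have hsq : (x - c) ^ 2 = r ^ 2 := by
    rcases hx with rfl | rfl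
    · rw [hf.centered.1]; ring
    · rw [hf.centered.2]; ring
  exact ⟨hxK, by simpa only [hf.eq_comp x hxK, hsq] using hf.boundary⟩

theorem continuousOn (hf : IsFoldBranch c r h f K J) : ContinuousOn f (pts K) :=
  (hf.diffeo.continuousOn.comp (by fun_prop) hf.mapsTo_sq).congr hf.eq_comp

theorem crossDiffeo (hf : IsFoldBranch c r h f K J) {a b : ℝ} (hab : a < b)
    (hsub : Icc a b ⊆ pts K) (hc : c < a ∨ b < c) : CrossDiffeo f a b :=
  (hf.diffeo.comp (.sq_sub hab hc) (hf.mapsTo_sq.mono_left hsub)).congr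
    fun x hx => hf.eq_comp x (hsub hx)

theorem congr (hf : IsFoldBranch c r h f K J) (e : EqOn g f (pts K)) :
    IsFoldBranch c r h g K J :=
  { hf with eq_comp := fun x hx => (e hx).trans (hf.eq_comp x hx) }

end IsFoldBranch

theorem IsFullBranch.comp_of_image_eq (hF : IsFullBranch F D L) (hf : CrossDiffeo f K.fst K.snd)
    (hi : f '' pts K = pts D) : IsFullBranch (F ∘ f) K L :=
  ⟨hF.1.comp hf (mapsTo_iff_image_subset.2 hi.subset), by rw [image_comp, hi, hF.2]⟩

theorem IsFullBranch.apply_boundary (hF : IsFullBranch F D L) {x : ℝ}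
    (hx : x = D.fst ∨ x = D.snd) : F x = L.fst ∨ F x = L.snd := by
  rcases hF.1.endpoints hF.2 with h | h <;> rcases hx with rfl | rfl <;> tauto

namespace IsBranch

theorem congr (hf : IsBranch c f K L) (e : EqOn g f (pts K)) : IsBranch c g K L :=
  ⟨fun hc => let ⟨r, h, hr⟩ := hf.1 hc; ⟨r, h, hr.congr e⟩,
    fun hc => ⟨(hf.2 hc).1.congr e, e.image_eq.trans (hf.2 hc).2⟩⟩

theorem lt (hf : IsBranch c f K L) : K.fst < K.snd := by
  by_cases hc : c ∈ pts K
  · obtain ⟨r, h, hr⟩ := hf.1 hc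
    linarith [hr.pos, hr.centered.1, hr.centered.2]
  · exact (hf.2 hc).1.lt

end IsBranch

/-! ### Pulling back a full branch through a fold -/

theorem CrossDiffeo.exists_component_pullback {a b x : ℝ} (hf : CrossDiffeo f a b)
    (hF : IsFullBranch F D L) (hsub : Icc a b ⊆ pts I) (ha : f a ∉ pts D) (hb : f b ∉ pts D)
    (hx : x ∈ Icc a b) (hfx : f x ∈ pts D) :
    ∃ K : Seg, a < K.fst ∧ K.snd < b ∧ IsFullBranch (F ∘ f) K L ∧
      pts K = ordConnectedComponent {z ∈ pts I | f z ∈ pts D} x := by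
  obtain ⟨K, haK, hK, hKb, hpts, himage⟩ := hf.exists_pullback hF.1.lt ha hb hx hfx
  refine ⟨K, haK, hKb, hF.comp_of_image_eq (hf.restrict haK.le hK hKb.le) himage,
    (subset_ordConnectedComponent (h := ordConnected_pts) (hpts ▸ ⟨hx, hfx⟩) ?_).antisymm ?_⟩
  · exact hpts ▸ fun z hz => ⟨hsub hz.1, hz.2⟩
  · intro y hy
    have hya : a < y := by
      by_contra! h
      exact ha (hy (mem_uIcc_of_ge h hx.1)).2
    have hyb : y < b := by
      by_contra! h
      exact hb (hy (mem_uIcc_of_le hx.2 h)).2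
    exact hpts ▸ ⟨⟨hya.le, hyb.le⟩, (hy right_mem_uIcc).2⟩

/-- The critical value lies outside `D`: cut `I` at a point near `c` not mapped into `D`. -/
theorem IsFoldBranch.exists_component_pullback_of_notMem (hf : IsFoldBranch c r h f I J)
    (hF : IsFullBranch F D L) (hDJ : J.fst < D.fst ∧ D.snd < J.snd) {x : ℝ} (hx : x ∈ pts I)
    (hfx : f x ∈ pts D) (hcrit : f c ∉ pts D) :
    ∃ K : Seg, I.fst < K.fst ∧ K.snd < I.snd ∧ IsBranch c (F ∘ f) K L ∧
      pts K = ordConnectedComponent {z ∈ pts I | f z ∈ pts D} x := by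
  have hclosed : IsClosed {z ∈ pts I | f z ∈ pts D} :=
    hf.continuousOn.preimage_isClosed_of_isClosed isClosed_Icc isClosed_Icc
  have hnhds : ∀ᶠ s in nhds c, s ∉ {z ∈ pts I | f z ∈ pts D} :=
    hclosed.isOpen_compl.mem_nhds fun h => hcrit h.2
  have hfst := hf.apply_boundary (.inl rfl)
  have hsnd := hf.apply_boundary (.inr rfl)
  have hcI := hf.mem
  rcases lt_trichotomy x c with hxc | rfl | hcx
  · obtain ⟨s, hs, hxs, hsc⟩ := ((hnhds.filter_mono nhdsWithin_le_nhds).and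
      (Ioo_mem_nhdsLT hxc)).exists
    have hsub : Icc I.fst s ⊆ pts I := Icc_subset_Icc_right (hsc.le.trans hcI.2)
    have hs' : f s ∉ pts D := fun h => hs ⟨hsub ⟨hx.1.trans hxs.le, le_rfl⟩, h⟩
    obtain ⟨K, h1, h2, h3, h4⟩ := (hf.crossDiffeo (hx.1.trans_lt hxs) hsub
      (.inr hsc)).exists_component_pullback hF hsub (notMem_pts_of_boundary hDJ hfst.2) hs'
      ⟨hx.1, hxs.le⟩ hfx
    exact ⟨K, h1, by linarith [hcI.2], ⟨fun hc => absurd hc.2 (by linarith), fun _ => h3⟩, h4⟩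
  · exact absurd hfx hcrit
  · obtain ⟨s, hs, hcs, hsx⟩ := ((hnhds.filter_mono nhdsWithin_le_nhds).and
      (Ioo_mem_nhdsGT hcx)).exists
    have hsub : Icc s I.snd ⊆ pts I := Icc_subset_Icc_left (hcI.1.trans hcs.le)
    have hs' : f s ∉ pts D := fun h => hs ⟨hsub ⟨le_rfl, hsx.le.trans hx.2⟩, h⟩
    obtain ⟨K, h1, h2, h3, h4⟩ := (hf.crossDiffeo (hsx.trans_le hx.2) hsub
      (.inl hcs)).exists_component_pullback hF hsub hs' (notMem_pts_of_boundary hDJ hsnd.2)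
      ⟨hsx.le, hx.2⟩ hfx
    exact ⟨K, by linarith [hcI.1], h2, ⟨fun hc => absurd hc.1 (by linarith), fun _ => h3⟩, h4⟩

theorem IsFoldBranch.exists_component_pullback_of_mem (hf : IsFoldBranch c r h f I J)
    (hF : IsFullBranch F D L) (hDJ : J.fst < D.fst ∧ D.snd < J.snd) {x : ℝ} (hx : x ∈ pts I)
    (hfx : f x ∈ pts D) (hcrit : f c ∈ pts D) (hne : ¬(F (f c) = L.fst ∨ F (f c) = L.snd)) :
    ∃ K : Seg, I.fst < K.fst ∧ K.snd < I.snd ∧ IsBranch c (F ∘ f) K L ∧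
      pts K = ordConnectedComponent {z ∈ pts I | f z ∈ pts D} x := by
  have hhD : h 0 ∈ pts D := hf.apply_critical ▸ hcrit
  obtain ⟨t, ht0, htr, hpre, hht⟩ := hf.diffeo.exists_pullback_left hhD
    (notMem_pts_of_boundary hDJ hf.boundary)
  replace hne : ¬(F (h 0) = L.fst ∨ F (h 0) = L.snd) := hf.apply_critical ▸ hne
  have ht : 0 < t := ht0.lt_of_ne (by rintro rfl; exact hne (hF.apply_boundary hht))
  have hsqrt : √t < r := (Real.sqrt_lt' hf.pos).2 htr
  have hK : IsCentered c ⟨(c - √t, c + √t), by linarith [Real.sqrt_nonneg t]⟩ √t := ⟨rfl, rfl⟩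
  set K : Seg := ⟨(c - √t, c + √t), by linarith [Real.sqrt_nonneg t]⟩
  have hpts : pts K = {z ∈ pts I | f z ∈ pts D} := by
    ext z
    rw [hK.mem_pts_iff (Real.sqrt_nonneg t), Real.sq_sqrt ht0, ← hpre]
    exact (and_congr_left' (hf.centered.mem_pts_iff hf.pos.le).symm).trans
      (and_congr_right fun hz => by rw [hf.eq_comp z hz])
  have hmaps : MapsTo h (Icc 0 t) (pts D) := fun z hz => (hpre ▸ hz : z ∈ {z ∈ _ | h z ∈ _}).2
  refine ⟨K, by rw [hf.centered.1, hK.1]; linarith, by rw [hf.centered.2, hK.2]; linarith,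
    ⟨fun _ => ⟨√t, F ∘ h, ?_⟩, fun hc => absurd ?_ hc⟩, ?_⟩
  · exact
      { pos := Real.sqrt_pos.2 ht
        centered := hK
        diffeo := by
          rw [Real.sq_sqrt ht0]
          exact hF.1.comp (hf.diffeo.restrict le_rfl ht htr.le) hmaps
        eq_comp := fun z hz => congrArg F (hf.eq_comp z (hpts ▸ hz : z ∈ {z ∈ _ | f z ∈ _}).1)
        critical_mem := hF.2 ▸ mem_image_of_mem F hhD
        boundary := by
          rw [Real.sq_sqrt ht0]
          exact hF.apply_boundary hht }
  · exact hpts ▸ ⟨hf.mem, hcrit⟩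
  · refine (subset_ordConnectedComponent (h := ordConnected_pts) (hpts ▸ ⟨hx, hfx⟩)
      hpts.subset).antisymm ?_
    exact ordConnectedComponent_subset.trans hpts.superset

theorem IsFold.exists_component_pullback (hf : IsFold c f I J) (hF : IsFullBranch F D L)
    (hDJ : J.fst < D.fst ∧ D.snd < J.snd) {x : ℝ} (hx : x ∈ pts I) (hfx : f x ∈ pts D)
    (hne : ¬(F (f c) = L.fst ∨ F (f c) = L.snd)) :
    ∃ K : Seg, I.fst < K.fst ∧ K.snd < I.snd ∧ IsBranch c (F ∘ f) K L ∧
      pts K = ordConnectedComponent {z ∈ pts I | f z ∈ pts D} x := by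
  obtain ⟨r, h, hr⟩ := hf
  by_cases hcrit : f c ∈ pts D
  · exact hr.exists_component_pullback_of_mem hF hDJ hx hfx hcrit hne
  · exact hr.exists_component_pullback_of_notMem hF hDJ hx hfx hcrit

end Branches

section FirstReturn

variable {c x y : ℝ} {G : RMap} {K K' : Seg} {k k' m s : ℕ}

/-- The properties of the maps of class `𝒯` that are inherited by their pre-renormalizations. -/
structure QuadBox (c : ℝ) (G : RMap) : Prop where
  interior : ∀ K ∈ G.pieces, G.J.fst < K.fst ∧ K.snd < G.J.snd
  disjoint : ∀ K ∈ G.pieces, ∀ K' ∈ G.pieces, K ≠ K' → Disjoint (pts K) (pts K')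
  branch : ∀ K ∈ G.pieces, IsBranch c G.g K G.J
  critical : ∃ K ∈ G.pieces, c ∈ pts K

/-- The points that follow the itinerary of `y` through non-central pieces during the first `m`
iterates and then are in the central piece. -/
def cylinder (c : ℝ) (G : RMap) (m : ℕ) (y : ℝ) : Set ℝ :=
  {z | (∀ i < m, ∃ K ∈ G.pieces, c ∉ pts K ∧ G.g^[i] y ∈ pts K ∧ G.g^[i] z ∈ pts K) ∧
    G.g^[m] z ∈ pts (centralPiece c G)}

theorem ClassT.quadBox (hG : ClassT c G) : QuadBox c G := by
  obtain ⟨I, hI, r, hr, h1, h2, h, hh, hgh, h0, hhr⟩ := hG.central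
  have hfold : IsFoldBranch c r h G.g I G.J :=
    ⟨hr, ⟨h1, h2⟩, hh.crossDiffeo (by positivity), hgh, h0, hhr⟩
  refine ⟨hG.interior, hG.disjoint, fun K hK => ⟨fun hc => ?_, fun hc => ?_⟩, I, hI, hfold.mem⟩
  · obtain rfl : K = I := by
      by_contra hne
      exact disjoint_left.1 (hG.disjoint K hK I hI hne) hc hfold.mem
    exact ⟨r, h, hfold⟩
  · exact ⟨(hG.noncentral K hK hc).1.crossDiffeo (hG.nondeg K hK), (hG.noncentral K hK hc).2⟩

namespace QuadBox

theorem eq_of_mem_pts (hG : QuadBox c G) (hK : K ∈ G.pieces) (hK' : K' ∈ G.pieces)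
    (hx : x ∈ pts K) (hx' : x ∈ pts K') : K = K' := by
  by_contra hne
  exact disjoint_left.1 (hG.disjoint K hK K' hK' hne) hx hx'

theorem centralPiece_mem (hG : QuadBox c G) : centralPiece c G ∈ G.pieces := by
  rw [centralPiece, dif_pos hG.critical]
  exact hG.critical.choose_spec.1

theorem mem_centralPiece (hG : QuadBox c G) : c ∈ pts (centralPiece c G) := by
  rw [centralPiece, dif_pos hG.critical]
  exact hG.critical.choose_spec.2

theorem eq_centralPiece (hG : QuadBox c G) (hK : K ∈ G.pieces) (hc : c ∈ pts K) :
    K = centralPiece c G :=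
  hG.eq_of_mem_pts hK hG.centralPiece_mem hc hG.mem_centralPiece

theorem notMem_centralPiece (hG : QuadBox c G) (hK : K ∈ G.pieces) (hc : c ∉ pts K)
    (hx : x ∈ pts K) : x ∉ pts (centralPiece c G) := fun hx' =>
  hc (hG.eq_of_mem_pts hK hG.centralPiece_mem hx hx' ▸ hG.mem_centralPiece)

theorem isFold (hG : QuadBox c G) : IsFold c G.g (centralPiece c G) G.J :=
  (hG.branch _ hG.centralPiece_mem).1 hG.mem_centralPiece

theorem isFullBranch (hG : QuadBox c G) (hK : K ∈ G.pieces) (hc : c ∉ pts K) :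
    IsFullBranch G.g K G.J :=
  (hG.branch K hK).2 hc

theorem centralPiece_mem_nhds (hG : QuadBox c G) : pts (centralPiece c G) ∈ nhds c := by
  obtain ⟨r, h, hf⟩ := hG.isFold
  have hr := hf.pos
  exact Icc_mem_nhds (by rw [hf.centered.1]; linarith) (by rw [hf.centered.2]; linarith)

/-! ### Components of the domain of the first return map -/

theorem cylinder_succ (hG : QuadBox c G) (hK : K ∈ G.pieces) (hc : c ∉ pts K) (hy : y ∈ pts K)
    (m : ℕ) : cylinder c G (m + 1) y = {z ∈ pts K | G.g z ∈ cylinder c G m (G.g y)} := by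
  ext z
  simp only [cylinder, mem_ofPred_eq, Nat.forall_lt_succ_left, Function.iterate_zero, id,
    Function.iterate_succ_apply, and_assoc]
  refine and_congr_left' ⟨?_, fun hz => ⟨K, hK, hc, hy, hz⟩⟩
  rintro ⟨K', hK', -, hy', hz'⟩
  exact hG.eq_of_mem_pts hK hK' hy hy' ▸ hz'

theorem exists_cylinder (hG : QuadBox c G) (m : ℕ) (hy : y ∈ cylinder c G m y) :
    ∃ D : Seg, pts D = cylinder c G m y ∧ IsFullBranch G.g^[m] D (centralPiece c G) ∧
      G.J.fst < D.fst ∧ D.snd < G.J.snd := by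
  induction m generalizing y with
  | zero =>
    refine ⟨centralPiece c G, by simp [cylinder], ⟨?_, image_id _⟩,
      hG.interior _ hG.centralPiece_mem⟩
    exact .id (hG.branch _ hG.centralPiece_mem).lt
  | succ m ih =>
    obtain ⟨K, hK, hcK, hyK, -⟩ := hy.1 0 m.succ_pos
    have hsucc := hG.cylinder_succ hK hcK (y := y) hyK m
    rw [hsucc] at hy ⊢
    obtain ⟨D, hD, hDI, hDJ⟩ := ih hy.2
    rw [← hD] at hy ⊢
    obtain ⟨hf, hfi⟩ := hG.isFullBranch hK hcK
    have hends := hf.endpoints hfi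
    obtain ⟨D', h1, h2, h3, hpts, himage⟩ := hf.exists_pullback hDI.1.lt
      (notMem_pts_of_boundary hDJ (hends.imp And.left And.left))
      (notMem_pts_of_boundary hDJ (hends.symm.imp And.right And.right)) hy.1 hy.2
    have hKJ := hG.interior K hK
    exact ⟨D', hpts, hDI.comp_of_image_eq (hf.restrict h1.le h2 h3.le) himage,
      hKJ.1.trans h1, h3.trans hKJ.2⟩

theorem returnTime_eq (hG : QuadBox c G) (hK : IsReturnSeg c G k K) (hx : x ∈ pts K) :
    returnTime c G x = k := by
  have hk : k ∈ {k : ℕ | 1 ≤ k ∧ G.g^[k] x ∈ pts (centralPiece c G)} :=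
    ⟨hK.1, hK.2.2.2 (mem_image_of_mem _ hx)⟩
  refine (Nat.sInf_le hk).antisymm ?_
  by_contra! hlt
  have hmem := Nat.sInf_mem ⟨k, hk⟩
  obtain ⟨K', hK', hc, hsub⟩ := hK.2.2.1 (returnTime c G x) hmem.1 hlt
  exact hG.notMem_centralPiece hK' hc (hsub (mem_image_of_mem _ hx)) hmem.2

theorem isReturnSeg_succ_iff (hG : QuadBox c G) (hx : x ∈ pts K) :
    IsReturnSeg c G (m + 1) K ↔
      pts K ⊆ {z ∈ pts (centralPiece c G) | G.g z ∈ cylinder c G m (G.g x)} := by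
  constructor
  · rintro ⟨-, hI, hpieces, hret⟩ z hz
    refine ⟨hI hz, fun i hi => ?_, hret (mem_image_of_mem _ hz)⟩
    obtain ⟨K', hK', hc, hsub⟩ := hpieces (i + 1) (by lia) (by lia)
    exact ⟨K', hK', hc, hsub (mem_image_of_mem _ hx), hsub (mem_image_of_mem _ hz)⟩
  · refine fun hK => ⟨by lia, fun z hz => (hK hz).1, fun i hi him => ?_, ?_⟩
    · obtain ⟨i, rfl⟩ := Nat.exists_eq_add_of_le' hi
      obtain ⟨K', hK', hc, hxK', -⟩ := (hK hx).2.1 i (by lia)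
      refine ⟨K', hK', hc, image_subset_iff.2 fun z hz => ?_⟩
      obtain ⟨K'', hK'', -, hxK'', hzK''⟩ := (hK hz).2.1 i (by lia)
      exact hG.eq_of_mem_pts hK'' hK' hxK'' hxK' ▸ hzK''
    · exact image_subset_iff.2 fun z hz => (hK hz).2.2

theorem eq_of_maximal (hG : QuadBox c G) (hK : Maximal (IsReturnSeg c G k) K)
    (hK' : Maximal (IsReturnSeg c G k') K') (hx : x ∈ pts K) (hx' : x ∈ pts K') : K = K' := by
  obtain rfl : k = k' := (hG.returnTime_eq hK.prop hx).symm.trans (hG.returnTime_eq hK'.prop hx')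
  obtain ⟨m, rfl⟩ := Nat.exists_eq_add_of_le' hK.prop.1
  have hunion : pts K ∪ pts K' = pts (K ⊔ K') :=
    Icc_union_Icc' (hx'.1.trans hx.2) (hx.1.trans hx'.2)
  have hxsup : x ∈ pts (K ⊔ K') := hunion.subset (.inl hx)
  have hsup : IsReturnSeg c G (m + 1) (K ⊔ K') := by
    rw [hG.isReturnSeg_succ_iff hxsup, ← hunion, union_subset_iff]
    exact ⟨(hG.isReturnSeg_succ_iff hx).1 hK.prop, (hG.isReturnSeg_succ_iff hx').1 hK'.prop⟩
  exact (hK.eq_of_le hsup le_sup_left).trans (hK'.eq_of_le hsup le_sup_right).symm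

theorem iterate_critical_notMem_boundary (hG : QuadBox c G) (hR : Recurrent c G) (k : ℕ) :
    ¬(G.g^[k] c = (centralPiece c G).fst ∨ G.g^[k] c = (centralPiece c G).snd) := by
  intro hk
  obtain ⟨r, h, hf⟩ := hG.isFold
  obtain ⟨K, hK, hcK⟩ := hR.1 (k + 1)
  rw [Function.iterate_succ_apply'] at hcK
  exact notMem_pts_of_boundary (hG.interior K hK) (hf.apply_boundary hk).2 hcK

theorem returnTime_spec (hG : QuadBox c G) (hR : Recurrent c G) (s : ℕ) :
    1 ≤ returnTime c G (G.g^[s] c) ∧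
      G.g^[returnTime c G (G.g^[s] c)] (G.g^[s] c) ∈ pts (centralPiece c G) := by
  obtain ⟨m, hm, hmem⟩ := Filter.frequently_atTop.1
    (mapClusterPt_iff_frequently.1 hR.2 _ hG.centralPiece_mem_nhds) (s + 1)
  refine Nat.sInf_mem (s := {k : ℕ | 1 ≤ k ∧ G.g^[k] (G.g^[s] c) ∈ pts (centralPiece c G)})
    ⟨m - s, by lia, ?_⟩
  rwa [← Function.iterate_add_apply, Nat.sub_add_cancel (by lia)]

theorem apply_mem_cylinder (hG : QuadBox c G) (hx : ∀ i, ∃ K ∈ G.pieces, G.g^[i] x ∈ pts K)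
    (hm : returnTime c G x = m + 1) (hret : G.g^[m + 1] x ∈ pts (centralPiece c G)) :
    G.g x ∈ cylinder c G m (G.g x) := by
  refine ⟨fun i hi => ?_, hret⟩
  obtain ⟨K, hK, hxK⟩ := hx (i + 1)
  refine ⟨K, hK, fun hcK => ?_, hxK, hxK⟩
  exact Nat.notMem_of_lt_sInf (hm.symm ▸ Nat.succ_lt_succ hi : i + 1 < returnTime c G x)
    ⟨i.succ_pos, hG.eq_centralPiece hK hcK ▸ hxK⟩

theorem exists_maximal_isReturnSeg (hG : QuadBox c G) (hR : Recurrent c G)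
    (hs : G.g^[s] c ∈ pts (centralPiece c G)) :
    ∃ k K, Maximal (IsReturnSeg c G k) K ∧ G.g^[s] c ∈ pts K ∧
      ((centralPiece c G).fst < K.fst ∧ K.snd < (centralPiece c G).snd) ∧
      IsBranch c G.g^[k] K (centralPiece c G) := by
  obtain ⟨hpos, hret⟩ := hG.returnTime_spec hR s
  have hiter : ∀ i, ∃ K ∈ G.pieces, G.g^[i] (G.g^[s] c) ∈ pts K := fun i => by
    rw [← Function.iterate_add_apply]
    exact hR.1 _
  set x := G.g^[s] c
  obtain ⟨m, hm⟩ := Nat.exists_eq_add_of_le' hpos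
  have hgx := hG.apply_mem_cylinder hiter hm (hm ▸ hret)
  obtain ⟨D, hD, hDI, hDJ⟩ := hG.exists_cylinder m hgx
  obtain ⟨K, h1, h2, hbranch, hpts⟩ := hG.isFold.exists_component_pullback hDI hDJ hs
    (hD ▸ hgx) (hG.iterate_critical_notMem_boundary hR (m + 1))
  rw [hD] at hpts
  have hxK : x ∈ pts K := hpts ▸ mem_ordConnectedComponent.2 (by simpa using ⟨hs, hgx⟩)
  refine ⟨m + 1, K, ⟨(hG.isReturnSeg_succ_iff hxK).2
    (hpts.trans_subset ordConnectedComponent_subset), fun K' hK' hle => ?_⟩, hxK, ⟨h1, h2⟩, hbranch⟩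
  have hxK' : x ∈ pts K' := ⟨hle.1.trans hxK.1, hxK.2.trans hle.2⟩
  exact le_of_pts_subset (hpts.symm ▸ subset_ordConnectedComponent (h := ordConnected_pts) hxK'
    ((hG.isReturnSeg_succ_iff hxK').1 hK'))

theorem exists_isReturnSeg_of_mem_preRenorm (hG : QuadBox c G) (hR : Recurrent c G)
    (hK : K ∈ (preRenorm c G).pieces) :
    ∃ k, IsReturnSeg c G k K ∧ ((centralPiece c G).fst < K.fst ∧ K.snd < (centralPiece c G).snd) ∧
      EqOn (preRenorm c G).g G.g^[k] (pts K) ∧ IsBranch c G.g^[k] K (centralPiece c G) := by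
  obtain ⟨⟨k, hmax⟩, s, hs⟩ := hK
  obtain ⟨k', K', hmax', hs', hint, hbranch⟩ :=
    hG.exists_maximal_isReturnSeg hR (hmax.prop.2.1 hs)
  obtain rfl := hG.eq_of_maximal hmax hmax' hs hs'
  refine ⟨k', hmax'.prop, hint, fun z hz => ?_, hbranch⟩
  exact congrArg (fun k => G.g^[k] z) (hG.returnTime_eq hmax'.prop hz)

end QuadBox

theorem QuadBox.preRenorm (hG : QuadBox c G) (hR : Recurrent c G) :
    QuadBox c (preRenorm c G) where
  interior K hK :=
    let ⟨_, _, h, _⟩ := hG.exists_isReturnSeg_of_mem_preRenorm hR hK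
    h
  disjoint := by
    rintro K ⟨⟨k, hK⟩, -⟩ K' ⟨⟨k', hK'⟩, -⟩ hne
    exact disjoint_left.2 fun z hz hz' => hne (hG.eq_of_maximal hK hK' hz hz')
  branch K hK :=
    let ⟨_, _, _, he, h⟩ := hG.exists_isReturnSeg_of_mem_preRenorm hR hK
    h.congr he
  critical :=
    let ⟨k, K, hK, hcK, _⟩ := hG.exists_maximal_isReturnSeg hR (s := 0) hG.mem_centralPiece
    ⟨K, ⟨⟨k, hK⟩, 0, hcK⟩, hcK⟩

/-! ### The critical orbit of the pre-renormalization -/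

/-- The number of iterates of `G` that make up `j` iterates of its pre-renormalization at `c`. -/
noncomputable def visitTime (c : ℝ) (G : RMap) : ℕ → ℕ
  | 0 => 0
  | j + 1 => returnTime c G (G.g^[visitTime c G j] c) + visitTime c G j

theorem iterate_preRenorm (j : ℕ) : (preRenorm c G).g^[j] c = G.g^[visitTime c G j] c := by
  induction j with
  | zero => rfl
  | succ j ih =>
    rw [Function.iterate_succ_apply', ih, visitTime, Function.iterate_add_apply]
    rfl

theorem strictMono_visitTime (hG : QuadBox c G) (hR : Recurrent c G) :
    StrictMono (visitTime c G) :=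
  strictMono_nat_of_lt_succ fun j =>
    Nat.lt_add_of_pos_left (hG.returnTime_spec hR (visitTime c G j)).1

theorem visitTime_mem (hG : QuadBox c G) (hR : Recurrent c G) (j : ℕ) :
    G.g^[visitTime c G j] c ∈ pts (centralPiece c G) := by
  cases j with
  | zero => exact hG.mem_centralPiece
  | succ j =>
    rw [visitTime, Function.iterate_add_apply]
    exact (hG.returnTime_spec hR _).2

theorem exists_visitTime_eq (hG : QuadBox c G) (hR : Recurrent c G)
    (hm : G.g^[m] c ∈ pts (centralPiece c G)) : ∃ j, visitTime c G j = m := by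
  have hmono := strictMono_visitTime hG hR
  obtain rfl | hpos := m.eq_zero_or_pos
  · exact ⟨0, rfl⟩
  obtain ⟨j, hj, hmj⟩ := hmono.exists_between_of_tendsto_atTop hmono.tendsto_atTop hpos
  refine ⟨j + 1, hmj.antisymm' ?_⟩
  rw [visitTime, ← Nat.le_sub_iff_add_le hj.le]
  refine Nat.sInf_le ⟨Nat.sub_pos_of_lt hj, ?_⟩
  rwa [← Function.iterate_add_apply, Nat.sub_add_cancel hj.le]

theorem Recurrent.preRenorm (hG : QuadBox c G) (hR : Recurrent c G) :
    Recurrent c (preRenorm c G) := by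
  refine ⟨fun j => ?_, mapClusterPt_iff_frequently.2 fun U hU =>
    Filter.frequently_atTop.2 fun N => ?_⟩
  · obtain ⟨k, K, hK, hmem, -⟩ := hG.exists_maximal_isReturnSeg hR (visitTime_mem hG hR j)
    exact ⟨K, ⟨⟨k, hK⟩, _, hmem⟩, iterate_preRenorm j ▸ hmem⟩
  · obtain ⟨m, hm, hmU, hmI⟩ := Filter.frequently_atTop.1 (mapClusterPt_iff_frequently.1 hR.2 _
      (Filter.inter_mem hU hG.centralPiece_mem_nhds)) (visitTime c G N)
    obtain ⟨j, rfl⟩ := exists_visitTime_eq hG hR hmI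
    exact ⟨j, (strictMono_visitTime hG hR).le_iff_le.1 hm, iterate_preRenorm j ▸ hmU⟩

end FirstReturn

section WellInside

/-- `D` lies in the interior of `L`, and the cross ratio `|D| |L| / (|U| |V|)`, with `U`, `V` the
components of `L \ D`, is at most `δ`. -/
def WellInside (δ : ℝ) (D L : Seg) : Prop :=
  L.fst < D.fst ∧ D.snd < L.snd ∧ len D * len L ≤ δ * ((D.fst - L.fst) * (L.snd - D.snd))

variable {c r R δ x y : ℝ} {f : ℝ → ℝ} {G : RMap} {D E I J K L V : Seg} {k m : ℕ}

theorem len_nonneg (K : Seg) : 0 ≤ len K := sub_nonneg.2 K.fst_le_snd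

theorem fst_mem_pts (K : Seg) : K.fst ∈ pts K := left_mem_Icc.2 K.fst_le_snd

theorem snd_mem_pts (K : Seg) : K.snd ∈ pts K := right_mem_Icc.2 K.fst_le_snd

theorem mul_add_add_le_of_le {s u v u' : ℝ} (hs : 0 ≤ s) (hu : 0 < u) (hv : 0 < v) (huu' : u ≤ u')
    (h : s * (u + s + v) ≤ δ * (u * v)) : s * (u' + s + v) ≤ δ * (u' * v) := by
  have hsδ : s ≤ δ * v := by
    refine le_of_mul_le_mul_right ?_ hu
    nlinarith [mul_nonneg hs hs, mul_nonneg hs hv.le]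
  nlinarith [mul_le_mul_of_nonneg_right hsδ (sub_nonneg.2 huu')]

namespace WellInside

theorem nonneg (h : WellInside δ D L) : 0 ≤ δ := by
  have hgap := mul_pos (sub_pos.2 h.1) (sub_pos.2 h.2.1)
  exact nonneg_of_mul_nonneg_left ((mul_nonneg (len_nonneg D) (len_nonneg L)).trans h.2.2) hgap

theorem sub_mul_len_le (h : WellInside δ D L) (hx : x ∈ pts D) (hy : y ∈ pts D) :
    (y - x) * len L ≤ δ * ((x - L.fst) * (L.snd - y)) := by
  have hδ := h.nonneg
  obtain ⟨hfst, hsnd, hcross⟩ := h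
  have hlen := len_nonneg L
  calc (y - x) * len L ≤ len D * len L := by
        gcongr
        exact sub_le_sub hy.2 hx.1
    _ ≤ δ * ((D.fst - L.fst) * (L.snd - D.snd)) := hcross
    _ ≤ δ * ((x - L.fst) * (L.snd - y)) := by
        have := hx.1
        have := hy.2
        gcongr
        · linarith

theorem mono_right (h : WellInside δ D K) (hfst : L.fst ≤ K.fst) (hsnd : K.snd ≤ L.snd) :
    WellInside δ D L := by
  simp only [WellInside, len] at h ⊢
  obtain ⟨h1, h2, h3⟩ := h
  refine ⟨hfst.trans_lt h1, h2.trans_le hsnd, ?_⟩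
  have hD := sub_nonneg.2 D.fst_le_snd
  have hleft := mul_add_add_le_of_le (δ := δ) (u' := D.fst - L.fst) hD (sub_pos.2 h1)
    (sub_pos.2 h2) (by linarith) (by linarith)
  have hright := mul_add_add_le_of_le (δ := δ) (u' := L.snd - D.snd) hD (sub_pos.2 h2)
    (sub_pos.2 (hfst.trans_lt h1)) (by linarith) (by linarith)
  linarith

theorem len_le_mul_sub_fst (h : WellInside δ D L) : len D ≤ δ * (D.fst - L.fst) := by
  have hδ := mul_nonneg h.nonneg (sub_pos.2 h.1).le
  have hD := D.fst_le_snd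
  obtain ⟨h1, h2, h3⟩ := h
  refine le_of_mul_le_mul_right (h3.trans ?_) (show 0 < len L by rw [len]; linarith)
  rw [len, ← mul_assoc]
  gcongr
  linarith

theorem len_le_mul_snd_sub (h : WellInside δ D L) : len D ≤ δ * (L.snd - D.snd) := by
  have hδ := mul_nonneg h.nonneg (sub_pos.2 h.2.1).le
  have hD := D.fst_le_snd
  obtain ⟨h1, h2, h3⟩ := h
  refine le_of_mul_le_mul_right (h3.trans ?_) (show 0 < len L by rw [len]; linarith)
  rw [len, mul_comm (D.fst - L.fst), ← mul_assoc]
  gcongr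
  linarith

end WellInside

theorem IsCentered.wellInside (hI : IsCentered c I r) (hJ : IsCentered c J R) (hrR : r < R) :
    WellInside (4 * (r * R) / (R - r) ^ 2) I J := by
  have hR : R - r ≠ 0 := (sub_pos.2 hrR).ne'
  refine ⟨by rw [hI.1, hJ.1]; linarith, by rw [hI.2, hJ.2]; linarith, le_of_eq ?_⟩
  rw [hI.len_eq, hJ.len_eq, hI.1, hI.2, hJ.1, hJ.2]
  field_simp
  ring

theorem IsFullBranch.wellInside (hf : IsFullBranch f K L) (hE : WellInside δ E L)
    (hDK : pts D ⊆ pts K) (hDE : MapsTo f (pts D) (pts E)) : WellInside δ D K := by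
  have hx := hDE (fst_mem_pts D)
  have hy := hDE (snd_mem_pts D)
  have hEL : L.fst < E.fst ∧ E.snd < L.snd := ⟨hE.1, hE.2.1⟩
  have hfst : K.fst < D.fst := (hDK (fst_mem_pts D)).1.lt_of_ne fun h =>
    notMem_pts_of_boundary hEL (hf.apply_boundary (.inl h.symm)) hx
  have hsnd : D.snd < K.snd := (hDK (snd_mem_pts D)).2.lt_of_ne fun h =>
    notMem_pts_of_boundary hEL (hf.apply_boundary (.inr h)) hy
  have hcross := hf.1.cross K.fst D.fst D.snd K.snd le_rfl hfst.le D.fst_le_snd hsnd.le le_rfl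
  have hgap : 0 < (D.fst - K.fst) * (K.snd - D.snd) :=
    mul_pos (sub_pos.2 hfst) (sub_pos.2 hsnd)
  refine ⟨hfst, hsnd, ?_⟩
  rcases hf.1.endpoints hf.2 with ⟨h1, h2⟩ | ⟨h1, h2⟩ <;> rw [h1, h2] at hcross
  · have hpos : 0 < (f D.fst - L.fst) * (L.snd - f D.snd) :=
      mul_pos (sub_pos.2 (hEL.1.trans_le hx.1)) (sub_pos.2 (hy.2.trans_lt hEL.2))
    refine le_of_mul_le_mul_right (hcross.trans ?_) hpos
    have := mul_le_mul_of_nonneg_right (hE.sub_mul_len_le hx hy) hgap.le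
    rw [len] at this
    linarith
  · have hpos : 0 < (f D.snd - L.fst) * (L.snd - f D.fst) :=
      mul_pos (sub_pos.2 (hEL.1.trans_le hy.1)) (sub_pos.2 (hx.2.trans_lt hEL.2))
    refine le_of_mul_le_mul_right ?_ hpos
    have := mul_le_mul_of_nonneg_right (hE.sub_mul_len_le hy hx) hgap.le
    simp only [len] at *
    linarith

namespace QuadBox

theorem exists_wellInside_of_mem_cylinder (hG : QuadBox c G)
    (hI : WellInside δ (centralPiece c G) G.J) (hy : y ∈ cylinder c G (m + 1) y) :
    ∃ K ∈ G.pieces, c ∉ pts K ∧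
      ∀ D : Seg, pts D ⊆ cylinder c G (m + 1) y → pts D ⊆ pts K ∧ WellInside δ D K := by
  induction m generalizing y with
  | zero =>
    obtain ⟨K, hK, hc, hyK, -⟩ := hy.1 0 Nat.one_pos
    refine ⟨K, hK, hc, fun D hD => ?_⟩
    rw [hG.cylinder_succ hK hc (y := y) hyK] at hD
    have hDK : pts D ⊆ pts K := fun z hz => (hD hz).1
    exact ⟨hDK, (hG.isFullBranch hK hc).wellInside hI hDK fun z hz => (hD hz).2.2⟩
  | succ m ih =>
    obtain ⟨K, hK, hc, hyK, -⟩ := hy.1 0 (by lia)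
    rw [hG.cylinder_succ hK hc (y := y) hyK] at hy ⊢
    obtain ⟨E, hE, -⟩ := hG.exists_cylinder (m + 1) hy.2
    obtain ⟨K', hK', -, hWI⟩ := ih hy.2
    have hEJ : WellInside δ E G.J := (hWI E hE.subset).2.mono_right
      (hG.interior K' hK').1.le (hG.interior K' hK').2.le
    refine ⟨K, hK, hc, fun D hD => ?_⟩
    have hDK : pts D ⊆ pts K := fun z hz => (hD hz).1
    exact ⟨hDK, (hG.isFullBranch hK hc).wellInside hEJ hDK fun z hz => hE ▸ (hD hz).2⟩

theorem exists_wellInside_of_isReturnSeg (hG : QuadBox c G)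
    (hI : WellInside δ (centralPiece c G) G.J) (hV : IsReturnSeg c G k V) (hk : k ≠ 1) :
    ∃ K ∈ G.pieces, c ∉ pts K ∧ ∀ D : Seg, pts D ⊆ G.g '' pts V → WellInside δ D K := by
  obtain ⟨m, rfl⟩ := Nat.exists_eq_add_of_le' (show 2 ≤ k by have := hV.1; lia)
  have hsub := (hG.isReturnSeg_succ_iff (fst_mem_pts V)).1 hV
  obtain ⟨K, hK, hc, hWI⟩ :=
    hG.exists_wellInside_of_mem_cylinder hI (hsub (fst_mem_pts V)).2
  exact ⟨K, hK, hc, fun D hD => (hWI D (hD.trans (image_subset_iff.2 fun z hz => (hsub hz).2))).2⟩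

end QuadBox

end WellInside

section Parameters

variable {a b c r δ ρ : ℝ} {f h : ℝ → ℝ} {G : RMap} {D J K U V : Seg}

/-! ### Distortion -/

theorem distortion_congr {f g : ℝ → ℝ} {S : Set ℝ} (hfg : EqOn f g S) :
    distortion f S = distortion g S := by
  refine biSup_congr fun x hx => biSup_congr fun y hy => ?_
  rw [derivWithin_congr hfg (hfg hx), derivWithin_congr hfg (hfg hy)]

theorem abs_derivWithin_lt_of_distortion_lt {S : Set ℝ} (hρ : distortion f S < ENNReal.ofReal ρ)
    {x y : ℝ} (hx : x ∈ S) (hy : y ∈ S) (hx0 : derivWithin f S x ≠ 0)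
    (hy0 : derivWithin f S y ≠ 0) :
    |derivWithin f S x| < Real.exp ρ * |derivWithin f S y| := by
  have hlt : ENNReal.ofReal (Real.log (|derivWithin f S x| / |derivWithin f S y|)) <
      ENNReal.ofReal ρ :=
    (le_iSup₂_of_le x hx (le_iSup₂_of_le y hy le_rfl) : _ ≤ distortion f S).trans_lt hρ
  replace hlt := (ENNReal.ofReal_lt_ofReal_iff'.1 hlt).1
  rwa [Real.log_lt_iff_lt_exp (by positivity), div_lt_iff₀ (by positivity)] at hlt

namespace CrossDiffeo

theorem derivWithin_ne_zero (hf : CrossDiffeo f a b) {x : ℝ} (hx : x ∈ Icc a b) :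
    derivWithin f (Icc a b) x ≠ 0 := by
  obtain ⟨d, hd, hfd⟩ := hf.hasDeriv x hx
  rwa [hfd.derivWithin (uniqueDiffOn_Icc hf.lt x hx)]

theorem exists_abs_sub_eq_derivWithin_mul (hf : CrossDiffeo f a b) {u v : ℝ} (hu : u ∈ Icc a b)
    (hv : v ∈ Icc a b) (huv : u < v) :
    ∃ x ∈ Icc a b, |f v - f u| = |derivWithin f (Icc a b) x| * (v - u) := by
  have hder : ∀ x ∈ Ioo u v, HasDerivAt f (derivWithin f (Icc a b) x) x := by
    intro x hx
    obtain ⟨d, -, hfd⟩ := hf.hasDeriv x ⟨hu.1.trans hx.1.le, hx.2.le.trans hv.2⟩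
    exact hfd.differentiableWithinAt.hasDerivWithinAt.hasDerivAt
      (Icc_mem_nhds (hu.1.trans_lt hx.1) (hx.2.trans_le hv.2))
  obtain ⟨x, hx, hslope⟩ := exists_hasDerivAt_eq_slope f _ huv
    (hf.continuousOn.mono (Icc_subset_Icc hu.1 hv.2)) hder
  refine ⟨x, ⟨hu.1.trans hx.1.le, hx.2.le.trans hv.2⟩, ?_⟩
  have huv' : 0 < v - u := sub_pos.2 huv
  rw [hslope, abs_div, abs_of_pos huv', div_mul_cancel₀ _ huv'.ne']

theorem abs_sub_mul_le (hf : CrossDiffeo f a b)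
    (hρ : distortion f (Icc a b) < ENNReal.ofReal ρ) {u v s t : ℝ} (hu : u ∈ Icc a b)
    (hv : v ∈ Icc a b) (hs : s ∈ Icc a b) (ht : t ∈ Icc a b) (huv : u ≤ v) (hst : s ≤ t) :
    |f v - f u| * (t - s) ≤ Real.exp ρ * |f t - f s| * (v - u) := by
  rcases huv.eq_or_lt with rfl | huv
  · simp
  rcases hst.eq_or_lt with rfl | hst
  · simp
  obtain ⟨x, hx, hfx⟩ := hf.exists_abs_sub_eq_derivWithin_mul hu hv huv
  obtain ⟨y, hy, hfy⟩ := hf.exists_abs_sub_eq_derivWithin_mul hs ht hst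
  have hxy := abs_derivWithin_lt_of_distortion_lt hρ hx hy (hf.derivWithin_ne_zero hx)
    (hf.derivWithin_ne_zero hy)
  have hpos : 0 ≤ (v - u) * (t - s) := mul_nonneg (sub_pos.2 huv).le (sub_pos.2 hst).le
  rw [hfx, hfy]
  linarith [mul_le_mul_of_nonneg_right hxy.le hpos]

end CrossDiffeo

theorem IsFoldBranch.image_sq (hf : IsFoldBranch c r h f K J) :
    (fun x => (x - c) ^ 2) '' pts K = Icc 0 (r ^ 2) := by
  refine hf.mapsTo_sq.image_subset.antisymm fun z hz => ⟨c + √z, ?_, ?_⟩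
  · rw [hf.centered.mem_pts_iff hf.pos.le, add_sub_cancel_left, Real.sq_sqrt hz.1]
    exact hz
  · simp only [add_sub_cancel_left, Real.sq_sqrt hz.1]

theorem IsFoldBranch.eqOn_quadFactor (hf : IsFoldBranch c r h G.g K J) :
    EqOn (quadFactor c G K) h (Icc 0 (r ^ 2)) := by
  intro z hz
  have hmem : c + √z ∈ pts K := by
    rw [hf.centered.mem_pts_iff hf.pos.le, add_sub_cancel_left, Real.sq_sqrt hz.1]
    exact hz
  rw [quadFactor, if_neg hf.mem.2.not_gt, hf.eq_comp _ hmem, add_sub_cancel_left,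
    Real.sq_sqrt hz.1]

theorem IsFoldBranch.distortion_le_distParam (hf : IsFoldBranch c r h G.g K J)
    (hK : K ∈ G.pieces) : distortion h (Icc 0 (r ^ 2)) ≤ distParam c G := by
  rw [← distortion_congr hf.eqOn_quadFactor, ← hf.image_sq]
  exact le_iSup₂ (f := fun K (_ : K ∈ G.pieces) =>
    distortion (quadFactor c G K) ((fun x => (x - c) ^ 2) '' pts K)) K hK

/-! ### Poincaré lengths -/

theorem log_one_add_div_nonneg {x y : ℝ} (hx : 0 ≤ x) (hy : 0 ≤ y) : 0 ≤ Real.log (1 + x / y) :=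
  Real.log_nonneg (le_add_of_nonneg_right (div_nonneg hx hy))

theorem le_two_mul_log_one_add {x : ℝ} (hx : 0 ≤ x) (h : Real.log (1 + x) ≤ 1) :
    x ≤ 2 * Real.log (1 + x) := by
  have hlog : 0 ≤ Real.log (1 + x) := Real.log_nonneg (by linarith)
  have hexp := Real.abs_exp_sub_one_le (x := Real.log (1 + x)) (by rwa [abs_of_nonneg hlog])
  rwa [Real.exp_log (by linarith), add_sub_cancel_left, abs_of_nonneg hlog, abs_of_nonneg hx]
    at hexp

theorem lamStar_nonneg (c : ℝ) (G : RMap) : 0 ≤ lamStar c G := ENNReal.toReal_nonneg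

theorem min_le_lamStar (hK : K ∈ G.pieces) (hc : c ∉ pts K) {t : ℝ}
    (ht : t ≤ poincareLen K G.J) : min t 1 ≤ lamStar c G := by
  have hlam : ENNReal.ofReal t ≤ lam c G :=
    (ENNReal.ofReal_le_ofReal ht).trans (le_iSup₂
      (f := fun K (_ : K ∈ {K ∈ G.pieces | c ∉ pts K}) => ENNReal.ofReal (poincareLen K G.J))
      K ⟨hK, hc⟩)
  have hmin : ENNReal.ofReal (min t 1) ≤ min (lam c G) 1 := by
    rw [ENNReal.ofReal_min, ENNReal.ofReal_one]
    exact min_le_min_right 1 hlam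
  rw [lamStar, ← ENNReal.ofReal_le_iff_le_toReal
    (ne_top_of_le_ne_top ENNReal.one_ne_top (min_le_right _ _))]
  exact hmin

namespace QuadBox

theorem min_log_fst_le_lamStar (hG : QuadBox c G) (hK : K ∈ G.pieces) (hc : c ∉ pts K) :
    min (Real.log (1 + len K / (K.fst - G.J.fst))) 1 ≤ lamStar c G :=
  min_le_lamStar hK hc (le_add_of_nonneg_right
    (log_one_add_div_nonneg (len_nonneg K) (sub_pos.2 (hG.interior K hK).2).le))

theorem min_log_snd_le_lamStar (hG : QuadBox c G) (hK : K ∈ G.pieces) (hc : c ∉ pts K) :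
    min (Real.log (1 + len K / (G.J.snd - K.snd))) 1 ≤ lamStar c G :=
  min_le_lamStar hK hc (le_add_of_nonneg_left
    (log_one_add_div_nonneg (len_nonneg K) (sub_pos.2 (hG.interior K hK).1).le))

end QuadBox

theorem le_two_mul_min_log {l k d e lam : ℝ} (hδ : 0 ≤ δ) (hk : 0 ≤ k) (hd : 0 < d) (he : 0 ≤ e)
    (hlk : l ≤ δ * k) (hle : l ≤ δ * e) (hlam : min (Real.log (1 + k / d)) 1 ≤ lam) :
    l ≤ 2 * δ * lam * (e + d) := by
  have hlog := log_one_add_div_nonneg hk hd.le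
  have hlam0 : 0 ≤ lam := (le_min hlog zero_le_one).trans hlam
  rcases le_total 1 (Real.log (1 + k / d)) with h | h
  · rw [min_eq_right h] at hlam
    calc l ≤ δ * e := hle
      _ ≤ 2 * δ * 1 * (e + d) := by nlinarith [mul_nonneg hδ hd.le, mul_nonneg hδ he]
      _ ≤ 2 * δ * lam * (e + d) := by gcongr
  · rw [min_eq_left h] at hlam
    have hkd : k ≤ 2 * lam * d := by
      rw [← div_le_iff₀ hd]
      exact (le_two_mul_log_one_add (div_nonneg hk hd.le) h).trans (by gcongr)
    calc l ≤ δ * k := hlk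
      _ ≤ δ * (2 * lam * d) := by gcongr
      _ ≤ 2 * δ * lam * (e + d) := by linarith [mul_nonneg (mul_nonneg hδ hlam0) he]

theorem WellInside.len_le_mul_len (h : WellInside δ D K) : len D ≤ δ * len K :=
  h.len_le_mul_sub_fst.trans <| mul_le_mul_of_nonneg_left
    (sub_le_sub_right (D.fst_le_snd.trans h.2.1.le) _) h.nonneg

namespace QuadBox

theorem len_le_lamStar_mul_sub_fst (hG : QuadBox c G) (hK : K ∈ G.pieces) (hc : c ∉ pts K)
    (hD : WellInside δ D K) : len D ≤ 2 * δ * lamStar c G * (D.fst - G.J.fst) := by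
  have := le_two_mul_min_log hD.nonneg (len_nonneg K) (sub_pos.2 (hG.interior K hK).1)
    (sub_pos.2 hD.1).le hD.len_le_mul_len hD.len_le_mul_sub_fst (hG.min_log_fst_le_lamStar hK hc)
  rwa [sub_add_sub_cancel] at this

theorem len_le_lamStar_mul_snd_sub (hG : QuadBox c G) (hK : K ∈ G.pieces) (hc : c ∉ pts K)
    (hD : WellInside δ D K) : len D ≤ 2 * δ * lamStar c G * (G.J.snd - D.snd) := by
  have := le_two_mul_min_log hD.nonneg (len_nonneg K) (sub_pos.2 (hG.interior K hK).2)
    (sub_pos.2 hD.2.1).le hD.len_le_mul_len hD.len_le_mul_snd_sub (hG.min_log_snd_le_lamStar hK hc)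
  rwa [add_comm, sub_add_sub_cancel] at this

end QuadBox

theorem asymLen_nonneg (h : Closer c U V) : 0 ≤ asymLen U V := by
  have hgap : 0 ≤ gapLen U V := by
    rcases h with h | h
    · exact le_max_of_le_left (sub_pos.2 h.2).le
    · exact le_max_of_le_right (sub_pos.2 h.2).le
  have hU := log_one_add_div_nonneg hgap (len_nonneg U)
  have hV := log_one_add_div_nonneg hgap (len_nonneg V)
  rw [asymLen]
  positivity

theorem gapParam_le (hU : U ∈ G.pieces) (hV : V ∈ G.pieces) (h : Closer c U V) :
    gapParam c G ≤ asymLen U V := by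
  refine csInf_le ⟨0, ?_⟩ ⟨U, hU, V, hV, h, rfl⟩
  rintro q ⟨U, -, V, -, h, rfl⟩
  exact asymLen_nonneg h

end Parameters

section OneLevel

variable {a b c r R s u v x y δ ρ : ℝ} {f h : ℝ → ℝ} {G : RMap} {I J K V : Seg}

/-! ### Estimates at one level -/

/-- `V` lies on one side of `c` and consists of the points `x` on that side with
`a ≤ |x - c| ≤ b`. -/
def HasRadii (c : ℝ) (V : Seg) (a b : ℝ) : Prop :=
  0 < a ∧ (V.fst = c + a ∧ V.snd = c + b ∨ V.fst = c - b ∧ V.snd = c - a)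

theorem exists_hasRadii (hc : c ∉ pts V) : ∃ a b, HasRadii c V a b := by
  rcases lt_or_ge c V.fst with h | h
  · exact ⟨V.fst - c, V.snd - c, sub_pos.2 h, .inl ⟨by ring, by ring⟩⟩
  · have hlt : V.snd < c := by
      by_contra! h'
      exact hc ⟨h, h'⟩
    exact ⟨c - V.snd, c - V.fst, sub_pos.2 hlt, .inr ⟨by ring, by ring⟩⟩

namespace HasRadii

theorem len_eq (hV : HasRadii c V a b) : len V = b - a := by
  rw [len]
  rcases hV.2 with ⟨h1, h2⟩ | ⟨h1, h2⟩ <;> rw [h1, h2] <;> ring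

theorem le (hV : HasRadii c V a b) : a ≤ b := by
  linarith [hV.len_eq, len_nonneg V]

theorem image_abs_sub (hV : HasRadii c V a b) : (fun x => |x - c|) '' pts V = Icc a b := by
  obtain ⟨ha, ⟨h1, h2⟩ | ⟨h1, h2⟩⟩ := hV <;> rw [pts, h1, h2] <;> ext d <;>
    simp only [mem_image, mem_Icc]
  · refine ⟨?_, fun hd => ⟨c + d, ⟨by linarith, by linarith⟩, ?_⟩⟩
    · rintro ⟨x, hx, rfl⟩
      rw [abs_of_pos (by linarith)]
      exact ⟨by linarith, by linarith⟩
    · rw [add_sub_cancel_left, abs_of_pos (by linarith)]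
  · refine ⟨?_, fun hd => ⟨c - d, ⟨by linarith, by linarith⟩, ?_⟩⟩
    · rintro ⟨x, hx, rfl⟩
      rw [abs_of_neg (by linarith)]
      exact ⟨by linarith, by linarith⟩
    · rw [sub_sub_cancel_left, abs_neg, abs_of_pos (by linarith)]

theorem exists_mem_abs_sub_eq (hV : HasRadii c V a b) :
    (∃ x ∈ pts V, |x - c| = a) ∧ ∃ y ∈ pts V, |y - c| = b :=
  ⟨hV.image_abs_sub.ge (left_mem_Icc.2 hV.le), hV.image_abs_sub.ge (right_mem_Icc.2 hV.le)⟩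

theorem lt_of_interior (hV : HasRadii c V a b) (hI : IsCentered c I R)
    (hVI : I.fst < V.fst ∧ V.snd < I.snd) : b < R := by
  rw [hI.1, hI.2] at hVI
  rcases hV.2 with ⟨_, _⟩ | ⟨_, _⟩ <;> linarith

theorem lt_of_disjoint (hV : HasRadii c V a b) (hI : IsCentered c I r)
    (hVI : Disjoint (pts V) (pts I)) : r < a := by
  obtain ⟨x, hx, hxa⟩ := hV.exists_mem_abs_sub_eq.1
  by_contra! hle
  rw [← hxa, abs_sub_le_iff] at hle
  refine disjoint_left.1 hVI hx ⟨?_, ?_⟩ <;> linarith [hI.1, hI.2]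

theorem closer (hV : HasRadii c V a b) (hI : IsCentered c I r) (hr : 0 ≤ r) (hra : r < a) :
    Closer c I V := by
  rw [Closer, hI.1, hI.2]
  rcases hV.2 with ⟨hfst, -⟩ | ⟨-, hsnd⟩
  · exact .inl ⟨by linarith, by linarith⟩
  · exact .inr ⟨by linarith, by linarith⟩

theorem gapLen_eq (hV : HasRadii c V a b) (hI : IsCentered c I r) (hr : 0 ≤ r) (hra : r < a) :
    gapLen I V = a - r := by
  have hab := hV.le
  rw [gapLen, hI.1, hI.2]
  rcases hV.2 with ⟨h1, h2⟩ | ⟨h1, h2⟩ <;> rw [h1, h2]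
  · rw [max_eq_left (by linarith)]
    ring
  · rw [max_eq_right (by linarith)]
    ring

end HasRadii

/-- The interval spanned by two points, in either order. -/
def hull (u v : ℝ) : Seg := ⟨(min u v, max u v), min_le_max⟩

theorem len_hull (u v : ℝ) : len (hull u v) = |v - u| := max_sub_min_eq_abs u v

theorem IsCentered.abs_sub_eq_of_boundary (hJ : IsCentered c J R) (hR : 0 ≤ R)
    (hx : x = J.fst ∨ x = J.snd) : |x - c| = R := by
  rcases hx with rfl | rfl
  · rw [hJ.1, sub_sub_cancel_left, abs_neg, abs_of_nonneg hR]
  · rw [hJ.2, add_sub_cancel_left, abs_of_nonneg hR]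

theorem IsCentered.abs_sub_le (hJ : IsCentered c J R) (hx : x ∈ pts J) : |x - c| ≤ R := by
  obtain ⟨h1, h2⟩ := hx
  rw [hJ.1] at h1
  rw [hJ.2] at h2
  exact abs_sub_le_iff.2 ⟨by linarith, by linarith⟩

theorem scaling_eq_div (hI : IsCentered c (centralPiece c G) r) (hJ : IsCentered c G.J R) :
    scaling c G = r / R := by
  rw [scaling, hI.len_eq, hJ.len_eq, mul_div_mul_left _ _ two_ne_zero]

theorem IsFoldBranch.uIcc_subset_image (hf : IsFoldBranch c r h f K J) (hVK : pts V ⊆ pts K)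
    (hx : x ∈ pts V) (hy : y ∈ pts V) :
    uIcc (h ((x - c) ^ 2)) (h ((y - c) ^ 2)) ⊆ f '' pts V := by
  rw [← hf.eq_comp x (hVK hx), ← hf.eq_comp y (hVK hy)]
  exact (isPreconnected_Icc.image f (hf.continuousOn.mono hVK)).ordConnected.uIcc_subset
    (mem_image_of_mem f hx) (mem_image_of_mem f hy)

namespace QuadBox

theorem exists_wellInside_hull_critical (hG : QuadBox c G) (hR : Recurrent c G)
    (hf : IsFoldBranch c r h G.g (centralPiece c G) G.J)
    (hI : WellInside δ (centralPiece c G) G.J) (hnc : G.g c ∉ pts (centralPiece c G)) :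
    ∃ s, IsCentered c (centralPiece c (BoxMap.preRenorm c G)) s ∧ s ^ 2 ≤ r ^ 2 ∧
      ∃ V ∈ G.pieces, c ∉ pts V ∧ WellInside δ (hull (h 0) (h (s ^ 2))) V := by
  have hH := hG.preRenorm hR
  obtain ⟨s, h', hf'⟩ := hH.isFold
  obtain ⟨k, hk, -⟩ := hG.exists_isReturnSeg_of_mem_preRenorm hR hH.centralPiece_mem
  have hsnd := snd_mem_pts (centralPiece c (BoxMap.preRenorm c G))
  have hk1 : k ≠ 1 := by
    rintro rfl
    exact hnc (hk.2.2.2 ⟨c, hf'.mem, rfl⟩)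
  obtain ⟨V, hV, hcV, hWI⟩ := hG.exists_wellInside_of_isReturnSeg hI hk hk1
  refine ⟨s, hf'.centered, ?_, V, hV, hcV, hWI _ ?_⟩
  · have := ((hf.centered.mem_pts_iff hf.pos.le).1 (hk.2.1 hsnd)).2
    rwa [hf'.centered.2, add_sub_cancel_left] at this
  · have := hf.uIcc_subset_image hk.2.1 hf'.mem hsnd
    rwa [sub_self, zero_pow two_ne_zero, hf'.centered.2, add_sub_cancel_left] at this

theorem exists_hasRadii_mul_le (hG : QuadBox c G) (hR : Recurrent c G)
    (hf : IsFoldBranch c r h G.g (centralPiece c G) G.J) (hJ : IsCentered c G.J R) (hR0 : 0 ≤ R)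
    (hI : WellInside δ (centralPiece c G) G.J) (hρ : distParam c G < ENNReal.ofReal ρ)
    (hnc : G.g c ∉ pts (centralPiece c G)) :
    ∃ V ∈ G.pieces, c ∉ pts V ∧ ∃ a b, HasRadii c V a b ∧
      scaling c (BoxMap.preRenorm c G) ^ 2 * (R - b) ≤ Real.exp ρ * δ * (b - a) := by
  obtain ⟨s, hs, hsr, V, hV, hcV, hD⟩ := hG.exists_wellInside_hull_critical hR hf hI hnc
  obtain ⟨a, b, hab⟩ := exists_hasRadii hcV
  refine ⟨V, hV, hcV, a, b, hab, ?_⟩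
  have himage : |h (s ^ 2) - h 0| ≤ δ * (b - a) := by
    rw [← len_hull, ← hab.len_eq]
    exact hD.len_le_mul_len
  have hcrit : |h 0 - c| ≤ b := by
    have : h 0 ∈ pts V := ⟨hD.1.le.trans (min_le_left _ _), (le_max_left _ _).trans hD.2.1.le⟩
    exact (hab.image_abs_sub.le (mem_image_of_mem _ this)).2
  have houter : R - b ≤ |h (r ^ 2) - h 0| := by
    have := abs_sub_le (h (r ^ 2)) (h 0) c
    rw [hJ.abs_sub_eq_of_boundary hR0 hf.boundary] at this
    linarith
  have hdist := hf.diffeo.abs_sub_mul_le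
    ((hf.distortion_le_distParam hG.centralPiece_mem).trans_lt hρ)
    (left_mem_Icc.2 (sq_nonneg r)) (right_mem_Icc.2 (sq_nonneg r))
    (left_mem_Icc.2 (sq_nonneg r)) ⟨sq_nonneg s, hsr⟩ (sq_nonneg r) (sq_nonneg s)
  rw [sub_zero, sub_zero] at hdist
  rw [scaling_eq_div hs hf.centered, div_pow, div_mul_eq_mul_div, div_le_iff₀ (pow_pos hf.pos 2)]
  calc s ^ 2 * (R - b) ≤ s ^ 2 * |h (r ^ 2) - h 0| := by gcongr
    _ ≤ Real.exp ρ * |h (s ^ 2) - h 0| * r ^ 2 := by rwa [mul_comm]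
    _ ≤ Real.exp ρ * (δ * (b - a)) * r ^ 2 := by gcongr
    _ = Real.exp ρ * δ * (b - a) * r ^ 2 := by ring

end QuadBox

theorem IsFoldBranch.sub_mul_le_of_apply_mem (hf : IsFoldBranch c r h f I J)
    (hJ : IsCentered c J R) (hR0 : 0 ≤ R) (hρ : distortion h (Icc 0 (r ^ 2)) < ENNReal.ofReal ρ)
    (hb : b ∈ Icc 0 r) (hbI : h (b ^ 2) ∈ pts I) :
    (R - r) * r ≤ 4 * Real.exp ρ * R * (r - b) := by
  have hbr : b ^ 2 ≤ r ^ 2 := pow_le_pow_left₀ hb.1 hb.2 2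
  have hinner : R - r ≤ |h (r ^ 2) - h (b ^ 2)| := by
    have := abs_sub_le (h (r ^ 2)) (h (b ^ 2)) c
    rw [hJ.abs_sub_eq_of_boundary hR0 hf.boundary] at this
    linarith [hf.centered.abs_sub_le hbI]
  have hwhole : |h (r ^ 2) - h 0| ≤ 2 * R := by
    have := abs_sub_le (h (r ^ 2)) c (h 0)
    rw [hJ.abs_sub_eq_of_boundary hR0 hf.boundary, abs_sub_comm c] at this
    linarith [hJ.abs_sub_le hf.critical_mem]
  have hdist := hf.diffeo.abs_sub_mul_le hρ ⟨sq_nonneg b, hbr⟩ (right_mem_Icc.2 (sq_nonneg r))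
    (left_mem_Icc.2 (sq_nonneg r)) (right_mem_Icc.2 (sq_nonneg r)) hbr (sq_nonneg r)
  rw [sub_zero] at hdist
  refine le_of_mul_le_mul_right ?_ hf.pos
  calc (R - r) * r * r = (R - r) * r ^ 2 := by ring
    _ ≤ |h (r ^ 2) - h (b ^ 2)| * r ^ 2 := by gcongr
    _ ≤ Real.exp ρ * |h (r ^ 2) - h 0| * (r ^ 2 - b ^ 2) := hdist
    _ ≤ Real.exp ρ * (2 * R) * ((r - b) * (2 * r)) := by
      have : r ^ 2 - b ^ 2 ≤ (r - b) * (2 * r) := by nlinarith [hb.1, hb.2]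
      gcongr
    _ = 4 * Real.exp ρ * R * (r - b) * r := by ring

namespace QuadBox

theorem abs_sub_le_lamStar_mul (hG : QuadBox c G) (hf : IsFoldBranch c r h f I G.J)
    (hK : K ∈ G.pieces) (hc : c ∉ pts K) (hx : 0 ≤ x) (hxy : x ≤ y) (hyr : y ≤ r ^ 2)
    (hD : WellInside δ (hull (h x) (h y)) K) :
    |h y - h x| ≤ 2 * δ * lamStar c G * |h (r ^ 2) - h y| := by
  obtain ⟨hJK, hKJ⟩ := hG.interior K hK
  have hmono : h y ∈ uIcc (h x) (h (r ^ 2)) :=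
    (hf.diffeo.mem_uIcc_iff ⟨hx, hxy.trans hyr⟩ (right_mem_Icc.2 (sq_nonneg r))
      ⟨hx.trans hxy, hyr⟩).2 (mem_uIcc.2 (.inl ⟨hxy, hyr⟩))
  rcases hf.boundary with hr | hr <;> rw [hr] at hmono ⊢
  · have hlt : G.J.fst < h x := hJK.trans (hD.1.trans_le (min_le_left _ _))
    rw [uIcc_of_ge hlt.le] at hmono
    have hfst : (hull (h x) (h y)).fst = h y := min_eq_right hmono.2
    have hlen : |G.J.fst - h y| = (hull (h x) (h y)).fst - G.J.fst := by
      rw [hfst, abs_sub_comm, abs_of_nonneg (sub_nonneg.2 hmono.1)]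
    rw [hlen, ← len_hull]
    exact hG.len_le_lamStar_mul_sub_fst hK hc hD
  · have hlt : h x < G.J.snd := ((le_max_left _ _).trans_lt hD.2.1).trans hKJ
    rw [uIcc_of_le hlt.le] at hmono
    have hsnd : (hull (h x) (h y)).snd = h y := max_eq_right hmono.1
    have hlen : |G.J.snd - h y| = G.J.snd - (hull (h x) (h y)).snd := by
      rw [hsnd, abs_of_nonneg (sub_nonneg.2 hmono.2)]
    rw [hlen, ← len_hull]
    exact hG.len_le_lamStar_mul_snd_sub hK hc hD

theorem sq_sub_sq_le (hG : QuadBox c G) (hf : IsFoldBranch c r h G.g (centralPiece c G) G.J)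
    (hρ : distParam c G < ENNReal.ofReal ρ) (hK : K ∈ G.pieces) (hc : c ∉ pts K) (ha : 0 ≤ a)
    (hab : a ≤ b) (hbr : b < r) (hD : WellInside δ (hull (h (a ^ 2)) (h (b ^ 2))) K) :
    b ^ 2 - a ^ 2 ≤ Real.exp ρ * (2 * δ * lamStar c G) * (r ^ 2 - b ^ 2) := by
  have hab' : a ^ 2 ≤ b ^ 2 := pow_le_pow_left₀ ha hab 2
  have hbr' : b ^ 2 < r ^ 2 := pow_lt_pow_left₀ hbr (ha.trans hab) two_ne_zero
  have hb : b ^ 2 ∈ Icc 0 (r ^ 2) := ⟨sq_nonneg b, hbr'.le⟩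
  have hr : r ^ 2 ∈ Icc 0 (r ^ 2) := right_mem_Icc.2 (sq_nonneg r)
  have hpos : 0 < |h (r ^ 2) - h (b ^ 2)| :=
    abs_pos.2 (sub_ne_zero.2 fun e => hbr'.ne' (hf.diffeo.injOn hr hb e))
  have hdist := hf.diffeo.abs_sub_mul_le
    ((hf.distortion_le_distParam hG.centralPiece_mem).trans_lt hρ) hb hr
    ⟨sq_nonneg a, hab'.trans hbr'.le⟩ hb hbr'.le hab'
  refine le_of_mul_le_mul_left (hdist.trans ?_) hpos
  calc Real.exp ρ * |h (b ^ 2) - h (a ^ 2)| * (r ^ 2 - b ^ 2)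
      ≤ Real.exp ρ * (2 * δ * lamStar c G * |h (r ^ 2) - h (b ^ 2)|) * (r ^ 2 - b ^ 2) := by
        gcongr
        exact hG.abs_sub_le_lamStar_mul hf hK hc (sq_nonneg a) hab' hbr'.le hD
    _ = |h (r ^ 2) - h (b ^ 2)| *
        (Real.exp ρ * (2 * δ * lamStar c G) * (r ^ 2 - b ^ 2)) := by ring

theorem outer_gap_alternative (hG : QuadBox c G) (hR : Recurrent c G)
    (hf : IsFoldBranch c r h G.g (centralPiece c G) G.J) (hJ : IsCentered c G.J R) (hR0 : 0 ≤ R)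
    (hI : WellInside δ (centralPiece c G) G.J) (hρ : distParam c G < ENNReal.ofReal ρ)
    (hV : V ∈ (BoxMap.preRenorm c G).pieces) (hab : HasRadii c V a b) :
    (R - r) * r ≤ 4 * Real.exp ρ * R * (r - b) ∨
      b ^ 2 - a ^ 2 ≤ Real.exp ρ * (2 * δ * lamStar c G) * (r ^ 2 - b ^ 2) := by
  obtain ⟨k, hk, hint, -⟩ := hG.exists_isReturnSeg_of_mem_preRenorm hR hV
  have hbr : b < r := hab.lt_of_interior hf.centered hint
  have himage : uIcc (h (a ^ 2)) (h (b ^ 2)) ⊆ G.g '' pts V := by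
    obtain ⟨⟨x, hx, rfl⟩, y, hy, rfl⟩ := hab.exists_mem_abs_sub_eq
    rw [sq_abs, sq_abs]
    exact hf.uIcc_subset_image hk.2.1 hx hy
  by_cases hk1 : k = 1
  · subst hk1
    exact .inl <| hf.sub_mul_le_of_apply_mem hJ hR0
      ((hf.distortion_le_distParam hG.centralPiece_mem).trans_lt hρ)
      ⟨hab.1.le.trans hab.le, hbr.le⟩ (hk.2.2.2 (himage right_mem_uIcc))
  · obtain ⟨K, hK, hc, hWI⟩ := hG.exists_wellInside_of_isReturnSeg hI hk hk1
    exact .inr <| hG.sq_sub_sq_le hf hρ hK hc hab.1.le hab.le hbr (hWI _ himage)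

end QuadBox

end OneLevel

section ThreeLevels

variable {a b c r R t x y ε ρ μ C N : ℝ} {G : RMap} {V : Seg}

/-! ### Three consecutive levels -/

/-- The constant in terms of which all estimates are uniform: a distortion factor `exp ρ` and the
square of the relative space `1 - μ` around a central interval of scaling factor `μ`. -/
noncomputable def distConst (ρ μ : ℝ) : ℝ := Real.exp ρ / (1 - μ) ^ 2

theorem distConst_pos (hμ : μ < 1) : 0 < distConst ρ μ :=
  div_pos (Real.exp_pos ρ) (pow_pos (sub_pos.2 hμ) 2)

theorem exp_le_mul_distConst (hμ0 : 0 ≤ μ) (hμ : μ < 1) :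
    Real.exp ρ ≤ (1 - μ) * distConst ρ μ := by
  have : 0 < 1 - μ := sub_pos.2 hμ
  rw [distConst, ← mul_div_assoc, le_div_iff₀ (by positivity), sq, ← mul_assoc, mul_comm (1 - μ)]
  exact mul_le_of_le_one_right (by positivity) (by linarith)

theorem one_le_distConst (hρ : 0 ≤ ρ) (hμ0 : 0 ≤ μ) (hμ : μ < 1) : 1 ≤ distConst ρ μ := by
  have hμ' : 0 < 1 - μ := sub_pos.2 hμ
  rw [distConst, one_le_div (by positivity)]
  exact (pow_le_one₀ hμ'.le (by linarith)).trans (Real.one_le_exp hρ)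

theorem exp_mul_crossRatio_le (hr : 0 < r) (hR : 0 < R) (hs : r / R < μ) (hμ : μ < 1) :
    Real.exp ρ * (4 * (r * R) / (R - r) ^ 2) ≤ 4 * distConst ρ μ * (r / R) := by
  have hspace : (1 - μ) * R ≤ R - r := by
    rw [div_lt_iff₀ hR] at hs
    linarith
  have hμ' : 0 < 1 - μ := sub_pos.2 hμ
  calc Real.exp ρ * (4 * (r * R) / (R - r) ^ 2)
      ≤ Real.exp ρ * (4 * (r * R) / ((1 - μ) * R) ^ 2) := by gcongr
    _ = 4 * distConst ρ μ * (r / R) := by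
      rw [distConst]
      field_simp

theorem exp_neg_alternative {K : ℝ} (hy : 0 ≤ y) (hKxy : K ≤ x + 1 / 2 * y) (ε : ℝ) :
    Real.exp (-x) ≤ Real.exp (-(1 - ε) * K) ∨
      Real.exp (-x) * Real.exp (-y) ≤ Real.exp (-(1 + ε / 2) * K) := by
  rw [← Real.exp_add, Real.exp_le_exp, Real.exp_le_exp]
  rcases le_total (1 / 2 * y) (ε * K) with h | h
  · exact .inl (by linarith)
  · exact .inr (by linarith)

theorem exp_neg_log_one_add_div (hx : 0 ≤ x) (hy : 0 < y) :
    Real.exp (-Real.log (1 + x / y)) = y / (y + x) := by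
  rw [Real.exp_neg, Real.exp_log (by positivity), one_add_div hy.ne', inv_div]

theorem le_mul_sqrt_of_sq_le (hC : 0 ≤ C) (h : x ^ 2 ≤ C ^ 2 * t) : x ≤ C * √t := by
  rw [← Real.sqrt_sq hC, ← Real.sqrt_mul (sq_nonneg C)]
  exact Real.le_sqrt_of_sq_le h

namespace QuadBox

theorem wellInside_centralPiece (hG : QuadBox c G) (hI : IsCentered c (centralPiece c G) r)
    (hJ : IsCentered c G.J R) :
    WellInside (4 * (r * R) / (R - r) ^ 2) (centralPiece c G) G.J := by
  have hint := (hG.interior _ hG.centralPiece_mem).2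
  rw [hI.2, hJ.2] at hint
  exact hI.wellInside hJ (by linarith)

theorem scaling_pos (hG : QuadBox c G) : 0 < scaling c G := by
  have hI := (hG.branch _ hG.centralPiece_mem).lt
  have hint := hG.interior _ hG.centralPiece_mem
  exact div_pos (sub_pos.2 hI) (sub_pos.2 (by linarith))

theorem radius_pos (hG : QuadBox c G) (hJ : IsCentered c G.J R) : 0 < R := by
  have hint := hG.interior _ hG.centralPiece_mem
  have hI := hG.mem_centralPiece
  linarith [hJ.2, hI.2]

theorem exists_hasRadii_scaling_sq_le (hG : QuadBox c G) (hR : Recurrent c G)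
    (hJ : IsCentered c G.J R) (hρ : distParam c G < ENNReal.ofReal ρ) (hs : scaling c G < μ)
    (hμ : μ < 1) (hnc : G.g c ∉ pts (centralPiece c G)) :
    ∃ V ∈ G.pieces, c ∉ pts V ∧ ∃ a b, HasRadii c V a b ∧
      scaling c (BoxMap.preRenorm c G) ^ 2 ≤
        4 * distConst ρ μ * scaling c G * ((b - a) / (R - b)) := by
  obtain ⟨r, h, hf⟩ := hG.isFold
  have hR0 := hG.radius_pos hJ
  obtain ⟨V, hV, hcV, a, b, hab, hle⟩ := hG.exists_hasRadii_mul_le hR hf hJ hR0.le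
    (hG.wellInside_centralPiece hf.centered hJ) hρ hnc
  refine ⟨V, hV, hcV, a, b, hab, ?_⟩
  have hbR := hab.lt_of_interior hJ (hG.interior V hV)
  rw [scaling_eq_div hf.centered hJ] at hs ⊢
  rw [← mul_div_assoc, le_div_iff₀ (sub_pos.2 hbR)]
  exact hle.trans <| mul_le_mul_of_nonneg_right (exp_mul_crossRatio_le hf.pos hR0 hs hμ)
    (sub_nonneg.2 hab.le)

theorem outer_gap_alternative_of_scaling_lt (hG : QuadBox c G) (hR : Recurrent c G)
    (hJ : IsCentered c G.J R) (hI : IsCentered c (centralPiece c G) r)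
    (hρ : distParam c G < ENNReal.ofReal ρ) (hs : scaling c G < μ) (hμ : μ < 1)
    (hV : V ∈ (BoxMap.preRenorm c G).pieces) (hab : HasRadii c V a b) :
    r ≤ 4 * distConst ρ μ * (r - b) ∨
      b ^ 2 - a ^ 2 ≤ 8 * distConst ρ μ * scaling c G * lamStar c G * (r ^ 2 - b ^ 2) := by
  obtain ⟨r', h, hf⟩ := hG.isFold
  obtain rfl : r' = r := by linarith [hf.centered.2, hI.2]
  have hR0 := hG.radius_pos hJ
  have hμ0 := hG.scaling_pos.le.trans hs.le
  have hb : b < r' := hab.lt_of_interior hI ((hG.preRenorm hR).interior V hV)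
  have hb0 : 0 ≤ b := hab.1.le.trans hab.le
  rw [scaling_eq_div hI hJ] at hs ⊢
  refine (hG.outer_gap_alternative hR hf hJ hR0.le (hG.wellInside_centralPiece hI hJ) hρ hV
    hab).imp (fun hgap => ?_) fun hgap => hgap.trans ?_
  · have hspace : (1 - μ) * R ≤ R - r' := by
      rw [div_lt_iff₀ hR0] at hs
      linarith
    refine le_of_mul_le_mul_left ?_ (mul_pos (sub_pos.2 hμ) hR0)
    calc (1 - μ) * R * r' ≤ (R - r') * r' := mul_le_mul_of_nonneg_right hspace hf.pos.le
      _ ≤ 4 * Real.exp ρ * R * (r' - b) := hgap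
      _ ≤ 4 * ((1 - μ) * distConst ρ μ) * R * (r' - b) := by
        have := exp_le_mul_distConst (ρ := ρ) hμ0 hμ
        have := sub_pos.2 hb
        gcongr
      _ = (1 - μ) * R * (4 * distConst ρ μ * (r' - b)) := by ring
  · have hsq : 0 ≤ r' ^ 2 - b ^ 2 := sub_nonneg.2 (pow_le_pow_left₀ hb0 hb.le 2)
    have hlam := mul_nonneg (lamStar_nonneg c G) hsq
    linarith [mul_le_mul_of_nonneg_right (exp_mul_crossRatio_le (ρ := ρ) hf.pos hR0 hs hμ) hlam]

theorem outer_ratio_le_lamStar (hG : QuadBox c G) (hJ : IsCentered c G.J R) (hV : V ∈ G.pieces)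
    (hc : c ∉ pts V) (hab : HasRadii c V a b) (hN : 2 ≤ N) (hRN : R ≤ N * (R - b)) :
    (b - a) / (R - b) ≤ N * lamStar c G := by
  have hb : 0 < R - b := sub_pos.2 (hab.lt_of_interior hJ (hG.interior V hV))
  have hlam : min (Real.log (1 + (b - a) / (R - b))) 1 ≤ lamStar c G := by
    rcases hab.2 with ⟨-, h2⟩ | ⟨h1, -⟩
    · have := hG.min_log_snd_le_lamStar hV hc
      rwa [hab.len_eq, hJ.2, h2, add_sub_add_left_eq_sub] at this
    · have := hG.min_log_fst_le_lamStar hV hc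
      rwa [hab.len_eq, hJ.1, h1, sub_sub_sub_cancel_left] at this
  rcases le_total 1 (Real.log (1 + (b - a) / (R - b))) with hlog | hlog
  · rw [min_eq_right hlog] at hlam
    calc (b - a) / (R - b) ≤ N * 1 := by
          rw [div_le_iff₀ hb]
          linarith [hab.1]
      _ ≤ N * lamStar c G := by gcongr
  · rw [min_eq_left hlog] at hlam
    calc (b - a) / (R - b) ≤ 2 * Real.log (1 + (b - a) / (R - b)) :=
          le_two_mul_log_one_add (div_nonneg (sub_nonneg.2 hab.le) hb.le) hlog
      _ ≤ N * lamStar c G := by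
        gcongr
        exact log_one_add_div_nonneg (sub_nonneg.2 hab.le) hb.le

theorem exists_gapParam_le (hG : QuadBox c G) (hJ : IsCentered c G.J R) (hV : V ∈ G.pieces)
    (hc : c ∉ pts V) (hab : HasRadii c V a b) (hRN : R ≤ N * (R - b)) :
    ∃ x y, 0 ≤ y ∧ gapParam c G ≤ x + 1 / 2 * y ∧ scaling c G ≤ Real.exp (-x) ∧
      (b - a) / (R - b) ≤ N * Real.exp (-y) := by
  obtain ⟨r, h, hf⟩ := hG.isFold
  have hr := hf.pos
  have hI := hf.centered
  have hbR : b < R := hab.lt_of_interior hJ (hG.interior V hV)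
  have hra : r < a :=
    hab.lt_of_disjoint hI (disjoint_left.2 fun x hx => hG.notMem_centralPiece hV hc hx)
  have hlen : 0 < b - a := hab.len_eq ▸ sub_pos.2 (hG.branch V hV).lt
  have hgap : 0 ≤ a - r := sub_nonneg.2 hra.le
  refine ⟨Real.log (1 + (a - r) / (2 * r)), Real.log (1 + (a - r) / (b - a)),
    log_one_add_div_nonneg hgap hlen.le, ?_, ?_, ?_⟩
  · rw [← hI.len_eq, ← hab.len_eq, ← hab.gapLen_eq hI hr.le hra]
    exact gapParam_le hG.centralPiece_mem hV (hab.closer hI hr.le hra)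
  · rw [exp_neg_log_one_add_div hgap (by positivity), scaling_eq_div hI hJ,
      ← mul_div_mul_left r R two_ne_zero]
    gcongr
    linarith
  · rw [exp_neg_log_one_add_div hgap hlen, ← mul_div_assoc, div_le_div_iff₀ (by linarith)
      (by linarith)]
    calc (b - a) * (b - a + (a - r)) ≤ (b - a) * (N * (R - b)) := by
          gcongr
          linarith
      _ = N * (b - a) * (R - b) := by ring

theorem inner_gap_alternative (hG : QuadBox c G) (hJ : IsCentered c G.J R) (hV : V ∈ G.pieces)
    (hc : c ∉ pts V) (hab : HasRadii c V a b) (hN : 2 ≤ N) (hRN : R ≤ N * (R - b)) (ε : ℝ) :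
    scaling c G * ((b - a) / (R - b)) ≤
        N * (lamStar c G * Real.exp (-(1 - ε) * gapParam c G)) ∨
      scaling c G * ((b - a) / (R - b)) ≤ N * Real.exp (-(1 + ε / 2) * gapParam c G) := by
  have : 0 ≤ N := zero_le_two.trans hN
  have hlam := hG.outer_ratio_le_lamStar hJ hV hc hab hN hRN
  have hlam0 := lamStar_nonneg c G
  have hs := hG.scaling_pos.le
  obtain ⟨x, y, hy, hKxy, hx, hW⟩ := hG.exists_gapParam_le hJ hV hc hab hRN
  refine (exp_neg_alternative hy hKxy ε).imp (fun h => ?_) fun h => ?_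
  · calc scaling c G * ((b - a) / (R - b)) ≤ scaling c G * (N * lamStar c G) := by gcongr
      _ ≤ Real.exp (-(1 - ε) * gapParam c G) * (N * lamStar c G) := by
        gcongr
        exact hx.trans h
      _ = N * (lamStar c G * Real.exp (-(1 - ε) * gapParam c G)) := by ring
  · calc scaling c G * ((b - a) / (R - b)) ≤ scaling c G * (N * Real.exp (-y)) := by gcongr
      _ ≤ Real.exp (-x) * (N * Real.exp (-y)) := by gcongr
      _ = N * (Real.exp (-x) * Real.exp (-y)) := by ring
      _ ≤ N * Real.exp (-(1 + ε / 2) * gapParam c G) := by gcongr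

end QuadBox

theorem ratio_le_of_sq_sub_sq_le {F : ℝ} (ha : 0 ≤ a) (hab : a ≤ b) (hbR : b < R)
    (hRb : R ≤ 2 * b) (hF : 0 ≤ F) (h : b ^ 2 - a ^ 2 ≤ F * (R ^ 2 - b ^ 2)) :
    (b - a) / (R - b) ≤ 4 * F := by
  have hR : 0 < R := (ha.trans hab).trans_lt hbR
  have hb := sub_pos.2 hbR
  rw [div_le_iff₀ hb]
  refine le_of_mul_le_mul_right ?_ (half_pos hR)
  calc (b - a) * (R / 2) ≤ (b - a) * (b + a) := by
        have := sub_nonneg.2 hab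
        gcongr
        linarith
    _ ≤ F * (R ^ 2 - b ^ 2) := by linarith
    _ = F * ((R - b) * (R + b)) := by ring
    _ ≤ F * ((R - b) * (2 * R)) := by
      gcongr
      linarith
    _ = 4 * F * (R - b) * (R / 2) := by ring

theorem QuadBox.scaling_mul_ratio_alternative (hG : QuadBox c G) (hR : Recurrent c G)
    (hJ : IsCentered c G.J R) (hI : IsCentered c (centralPiece c G) r)
    (hρ : distParam c G < ENNReal.ofReal ρ) (hs : scaling c G < μ) (hμ : μ < 1)
    (hV : V ∈ (BoxMap.preRenorm c G).pieces) (hc : c ∉ pts V) (hab : HasRadii c V a b) (ε : ℝ) :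
    ∃ T, scaling c (BoxMap.preRenorm c G) * ((b - a) / (r - b)) ≤ 36 * distConst ρ μ * T ∧
      (T = lamStar c (BoxMap.preRenorm c G) *
          Real.exp (-(1 - ε) * gapParam c (BoxMap.preRenorm c G)) ∨
        T = Real.exp (-(1 + ε / 2) * gapParam c (BoxMap.preRenorm c G)) ∨
        T = scaling c (BoxMap.preRenorm c G) * scaling c G * lamStar c G) := by
  have hH : QuadBox c (BoxMap.preRenorm c G) := hG.preRenorm hR
  have hsG := hG.scaling_pos.le
  have hsH := hH.scaling_pos.le
  have hlamG := lamStar_nonneg c G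
  have hlamH := lamStar_nonneg c (BoxMap.preRenorm c G)
  have hM : 1 ≤ distConst ρ μ :=
    one_le_distConst (ENNReal.ofReal_pos.1 (pos_of_gt hρ)).le (hsG.trans hs.le) hμ
  have hbr : b < r := hab.lt_of_interior hI (hH.interior V hV)
  by_cases hgap : r ≤ 4 * distConst ρ μ * (r - b)
  · rcases hH.inner_gap_alternative hI hV hc hab (by linarith) hgap ε with h | h
    · refine ⟨_, h.trans ?_, .inl rfl⟩
      gcongr
      norm_num
    · refine ⟨_, h.trans ?_, .inr (.inl rfl)⟩
      gcongr
      norm_num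
  · have hrb : r ≤ 2 * b := by
      by_contra! hlt
      nlinarith
    have hout := (hG.outer_gap_alternative_of_scaling_lt hR hJ hI hρ hs hμ hV hab).resolve_left hgap
    refine ⟨_, ?_, .inr (.inr rfl)⟩
    calc scaling c (BoxMap.preRenorm c G) * ((b - a) / (r - b))
        ≤ scaling c (BoxMap.preRenorm c G) *
            (4 * (8 * distConst ρ μ * scaling c G * lamStar c G)) := by
          gcongr
          exact ratio_le_of_sq_sub_sq_le hab.1.le hab.le hbr hrb (by positivity) hout
      _ = 32 * distConst ρ μ *
            (scaling c (BoxMap.preRenorm c G) * scaling c G * lamStar c G) := by ring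
      _ ≤ _ := by
        gcongr
        norm_num

theorem QuadBox.scaling_alternative (hG : QuadBox c G) (hR : Recurrent c G)
    (hJ : IsCentered c G.J R) (hμ : μ < 1) (hρ₁ : distParam c G < ENNReal.ofReal ρ)
    (hρ₂ : distParam c (BoxMap.preRenorm c G) < ENNReal.ofReal ρ) (hs₁ : scaling c G < μ)
    (hs₂ : scaling c (BoxMap.preRenorm c G) < μ)
    (hnc : (BoxMap.preRenorm c G).g c ∉ pts (centralPiece c (BoxMap.preRenorm c G))) (ε : ℝ) :
    let H := BoxMap.preRenorm c G
    let C := 12 * distConst ρ μ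
    scaling c (BoxMap.preRenorm c H) ≤
        C * (√(lamStar c H) * Real.exp (-(1 - ε) * gapParam c H / 2)) ∨
      scaling c (BoxMap.preRenorm c H) ≤ C * Real.exp (-(1 + ε / 2) * gapParam c H / 2) ∨
      scaling c (BoxMap.preRenorm c H) ≤ C * √(scaling c H * scaling c G * lamStar c G) := by
  intro H C
  have hH : QuadBox c H := hG.preRenorm hR
  have hM : 0 < distConst ρ μ := distConst_pos hμ
  obtain ⟨r, h, hf⟩ := hG.isFold
  obtain ⟨V, hV, hc, a, b, hab, hX⟩ :=
    hH.exists_hasRadii_scaling_sq_le (.preRenorm hG hR) hf.centered hρ₂ hs₂ hμ hnc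
  obtain ⟨T, hT, hcases⟩ :=
    hG.scaling_mul_ratio_alternative hR hJ hf.centered hρ₁ hs₁ hμ hV hc hab ε
  have hXT : scaling c (BoxMap.preRenorm c H) ≤ C * √T := by
    refine le_mul_sqrt_of_sq_le (by positivity) ?_
    calc scaling c (BoxMap.preRenorm c H) ^ 2
        ≤ 4 * distConst ρ μ * (scaling c H * ((b - a) / (r - b))) := hX.trans_eq (by ring)
      _ ≤ 4 * distConst ρ μ * (36 * distConst ρ μ * T) := by gcongr
      _ = C ^ 2 * T := by ring
  rw [Real.exp_half, Real.exp_half, ← Real.sqrt_mul (lamStar_nonneg c H)]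
  rcases hcases with rfl | rfl | rfl
  exacts [.inl hXT, .inr (.inl hXT), .inr (.inr hXT)]

/-! ### The sequence of pre-renormalizations -/

theorem level_succ (c : ℝ) (G : RMap) {n : ℕ} (hn : 1 ≤ n) :
    level c G (n + 1) = preRenorm c (level c G n) := by
  obtain ⟨m, rfl⟩ := Nat.exists_eq_add_of_le' hn
  exact Function.iterate_succ_apply' (preRenorm c) m G

theorem QuadBox.level_and_recurrent (hG : QuadBox c G) (hR : Recurrent c G) {n : ℕ} (hn : 1 ≤ n) :
    QuadBox c (level c G n) ∧ Recurrent c (level c G n) := by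
  induction n, hn using Nat.le_induction with
  | base => exact ⟨hG, hR⟩
  | succ n hn ih =>
    rw [level_succ c G hn]
    exact ⟨ih.1.preRenorm ih.2, .preRenorm ih.1 ih.2⟩

theorem QuadBox.exists_isCentered_level (hG : QuadBox c G) (hR : Recurrent c G) {n : ℕ}
    (hn : 1 ≤ n) (hsym : n = 1 → G.J.fst + G.J.snd = 2 * c) :
    ∃ R, IsCentered c (level c G n).J R := by
  obtain rfl | ⟨m, hm, rfl⟩ : n = 1 ∨ ∃ m, 1 ≤ m ∧ n = m + 1 := by
    rcases hn.eq_or_lt with h | h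
    · exact .inl h.symm
    · exact .inr ⟨n - 1, by omega, by omega⟩
  · refine ⟨G.J.snd - c, ?_, (add_sub_cancel c G.J.snd).symm⟩
    change G.J.fst = _
    linarith [hsym rfl]
  · obtain ⟨r, h, hf⟩ := (hG.level_and_recurrent hR hm).1.isFold
    rw [level_succ c G hm]
    exact ⟨r, hf.centered⟩

end ThreeLevels

end BoxMap

theorem lemma3p13_general (μbar ρbar : ℝ) (hμ : μbar < 1) :
    ∃ C > 0, ∀ (ε c : ℝ) (G : BoxMap.RMap), BoxMap.QuadBox c G → BoxMap.Recurrent c G →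
      ∀ n : ℕ, 2 ≤ n → (n = 2 → G.J.fst + G.J.snd = 2 * c) →
      BoxMap.distParam c (BoxMap.level c G (n - 1)) < ENNReal.ofReal ρbar →
      BoxMap.distParam c (BoxMap.level c G n) < ENNReal.ofReal ρbar →
      BoxMap.scaling c (BoxMap.level c G (n - 1)) < μbar →
      BoxMap.scaling c (BoxMap.level c G n) < μbar →
      (BoxMap.level c G n).g c ∉ BoxMap.pts (BoxMap.centralPiece c (BoxMap.level c G n)) →
      (BoxMap.scaling c (BoxMap.level c G (n + 1)) ≤
          C * (√(BoxMap.lamStar c (BoxMap.level c G n)) *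
            Real.exp (-(1 - ε) * BoxMap.gapParam c (BoxMap.level c G n) / 2)) ∨
        BoxMap.scaling c (BoxMap.level c G (n + 1)) ≤
          C * Real.exp (-(1 + ε / 2) * BoxMap.gapParam c (BoxMap.level c G n) / 2) ∨
        BoxMap.scaling c (BoxMap.level c G (n + 1)) ≤
          C * √(BoxMap.scaling c (BoxMap.level c G n) *
            BoxMap.scaling c (BoxMap.level c G (n - 1)) *
            BoxMap.lamStar c (BoxMap.level c G (n - 1)))) := by
  refine ⟨12 * BoxMap.distConst ρbar μbar,
    mul_pos (by norm_num) (BoxMap.distConst_pos hμ), ?_⟩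
  intro ε c G hG hR n hn hsym hρ₁ hρ₂ hs₁ hs₂ hnc
  obtain ⟨m, hm, rfl⟩ : ∃ m, 1 ≤ m ∧ n = m + 1 := ⟨n - 1, by omega, by omega⟩
  obtain ⟨R, hJ⟩ := hG.exists_isCentered_level hR hm fun h => hsym (by omega)
  obtain ⟨hGm, hRm⟩ := hG.level_and_recurrent hR hm
  rw [Nat.add_sub_cancel] at hρ₁ hs₁ ⊢
  rw [BoxMap.level_succ c G (Nat.le_add_left 1 m), BoxMap.level_succ c G hm] at *
  exact hGm.scaling_alternative hRm hJ hμ hρ₁ hρ₂ hs₁ hs₂ hnc ε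

theorem lemma3p13 (μbar ρbar ε : ℝ) (hρ : 0 < ρbar) (hρμ : ρbar < μbar) (hμ : μbar < 1)
    (hε : 0 < ε) :
    ∃ C > 0, ∀ (c : ℝ) (G : BoxMap.RMap), BoxMap.ClassT c G → BoxMap.Recurrent c G →
      ∀ n : ℕ, 2 ≤ n → (n = 2 → G.J.fst + G.J.snd = 2 * c) →
      BoxMap.distParam c (BoxMap.level c G (n - 1)) < ENNReal.ofReal ρbar →
      BoxMap.distParam c (BoxMap.level c G n) < ENNReal.ofReal ρbar →
      BoxMap.scaling c (BoxMap.level c G (n - 1)) < μbar →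
      BoxMap.scaling c (BoxMap.level c G n) < μbar →
      (BoxMap.level c G n).g c ∉ BoxMap.pts (BoxMap.centralPiece c (BoxMap.level c G n)) →
      (BoxMap.scaling c (BoxMap.level c G (n + 1)) ≤
          C * (√(BoxMap.lamStar c (BoxMap.level c G n)) *
            Real.exp (-(1 - ε) * BoxMap.gapParam c (BoxMap.level c G n) / 2)) ∨
        BoxMap.scaling c (BoxMap.level c G (n + 1)) ≤
          C * Real.exp (-(1 + ε / 2) * BoxMap.gapParam c (BoxMap.level c G n) / 2) ∨
        BoxMap.scaling c (BoxMap.level c G (n + 1)) ≤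
          C * √(BoxMap.scaling c (BoxMap.level c G n) *
            BoxMap.scaling c (BoxMap.level c G (n - 1)) *
            BoxMap.lamStar c (BoxMap.level c G (n - 1)))) := by
  obtain ⟨C, hC, h⟩ := lemma3p13_general μbar ρbar hμ
  exact ⟨C, hC, fun c G hG => h ε c G hG.quadBox⟩
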